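/- For integers $d\ge 0$ and $N\ge 2$ put $\delta=1/(N-1)$. The vertices of the grid are the vectors $v\in\{0,\dots,N-1\}^d$, where $v$ stands for the point $v/(N-1)\in[0,1]^d$. For $x\in[0,1]^d$ let $c=c(x)$ be the lexicographically first $c\in\{0,\dots,N-2\}^d$ such that $x$ lies in the cubelet $R(x)=\prod_i\left[\frac{c_i}{N-1},\frac{c_i+1}{N-1}\right]$, and let $R_c(x)=\prod_i\{c_i,c_i+1\}$ be the set of its corners. **Theorem.** There are an absolute constant $K$ and one algorithm $\mathcal A$ such that for every polynomial $q$ there is a polynomial $\tau$ with the following property. For every $d\in\mathbb N$ and every $N$ with $2\le N\le q(d)$ there is a family of functions $P_v:[0,1]^d\to\mathbb R$, $v\in\{0,\dots,N-1\}^d$, for which, with $R_+(x)=\{v: P_v(x)>0\}$, all of the following hold. (A) Every $P_v$ is twice continuously differentiable on $[0,1]^d$, and for all $x\in[0,1]^d$ and all $i,\ell$ $$\left|\frac{\partial P_v(x)}{\partial x_i}\right|\le K\,\frac{d^{12}}{\delta},\qquad \left|\frac{\partial^2 P_v(x)}{\partial x_i\,\partial x_\ell}\right|\le K\,\frac{d^{24}}{\delta^2}.$$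 (B) For all $x\in[0,1]^d$ and all $v$ we have $P_v(x)\ge 0$, and $\sum_{v}P_v(x)=\sum_{v\in R_c(x)}P_v(x)=1$. (C) For all $x\in[0,1]^d$ the set $R_+(x)$ has at most $d+1$ elements, $R_+(x)\subseteq R_c(x)$, and every $v\notin R_+(x)$ satisfies $P_v(x)=0$, $\nabla P_v(x)=0$ and $\nabla^2P_v(x)=0$. On input $(d,N,x)$ the algorithm $\mathcal A$ outputs the list of the elements of $R_+(x)$ in at most $\tau(d)$ steps. Here $\mathcal A$ is a program for a random access machine with exact real numbers that adds, subtracts and compares numbers (natural numbers and reals, starting from the input and the constant $1$, and arbitrary constants for natural numbers), with unit cost for each instruction and each comparison. (D) For all $x\in[0,1]^d$ and all $i$: if $x_i<1/(N-1)$, then there is $v\in R_+(x)$ with $v_i=0$; if $x_i>1-1/(N-1)$, then there is $v\in R_+(x)$ with $v_i=N-1$ (so that the $i$-th coordinate of the point $v/(N-1)$ is $1$). -/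

import Mathlib

namespace SEIC

/-! ### The grid on the unit cube -/

/-- The cube `[0,1]^d`. (Differentiability and partial derivatives do not depend on the norm that
`ℝ^d` carries.) -/
def unitCube (d : ℕ) : Set (Fin d → ℝ) := Set.Icc 0 1

/-- The side length `δ = 1/(N-1)` of a cubelet; it is used for `N ≥ 2` only. -/
noncomputable def meshSize (N : ℕ) : ℝ := 1 / ((N : ℝ) - 1)

/-- The cubelet `∏ i, [c i/(N-1), (c i + 1)/(N-1)]` with down-left corner `c`. -/
def cubelet {d : ℕ} (N : ℕ) (c : Fin d → ℕ) : Set (Fin d → ℝ) :=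
  {x | ∀ i, (c i : ℝ) / ((N : ℝ) - 1) ≤ x i ∧ x i ≤ ((c i : ℝ) + 1) / ((N : ℝ) - 1)}

/-- The down-left corner of the cubelet `R(x)`: the lexicographically first
`c ∈ {0, …, N-2}^d` whose cubelet contains `x`, see `cubeletCorner_isLeast`. -/
noncomputable def cubeletCorner {d : ℕ} (N : ℕ) (x : Fin d → ℝ) : Fin d → ℕ :=
  fun i => ⌈((N : ℝ) - 1) * x i⌉₊ - 1

theorem cubeletCorner_isLeast {d N : ℕ} (hN : 2 ≤ N) {x : Fin d → ℝ} (hx : x ∈ unitCube d) :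
    IsLeast (toLex '' {c : Fin d → ℕ | (∀ i, c i < N - 1) ∧ x ∈ cubelet N c})
      (toLex (cubeletCorner N x)) := by
  have hN' : (2 : ℝ) ≤ N := by exact_mod_cast hN
  have hpos : (0 : ℝ) < (N : ℝ) - 1 := by linarith
  have hcast : ((N - 1 : ℕ) : ℝ) = (N : ℝ) - 1 := by
    rw [Nat.cast_sub (by omega)]; simp
  have h0 : ∀ i, 0 ≤ x i := fun i => hx.1 i
  have h1 : ∀ i, x i ≤ 1 := fun i => hx.2 i
  refine ⟨⟨cubeletCorner N x, ⟨fun i => ?_, fun i => ⟨?_, ?_⟩⟩, rfl⟩, ?_⟩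
  · have : ⌈((N : ℝ) - 1) * x i⌉₊ ≤ N - 1 := by
      rw [Nat.ceil_le, hcast]
      nlinarith [h1 i]
    unfold cubeletCorner
    omega
  · rw [div_le_iff₀ hpos, mul_comm]
    unfold cubeletCorner
    rcases Nat.eq_zero_or_pos ⌈((N : ℝ) - 1) * x i⌉₊ with h | h
    · rw [h]
      simpa using mul_nonneg hpos.le (h0 i)
    · rw [Nat.cast_sub h]
      have := Nat.ceil_lt_add_one (mul_nonneg hpos.le (h0 i))
      push_cast
      linarith
  · rw [le_div_iff₀ hpos, mul_comm]
    have h2 := Nat.le_ceil (((N : ℝ) - 1) * x i)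
    have h3 : ⌈((N : ℝ) - 1) * x i⌉₊ ≤ cubeletCorner N x i + 1 := by
      unfold cubeletCorner
      omega
    have h4 : (⌈((N : ℝ) - 1) * x i⌉₊ : ℝ) ≤ (cubeletCorner N x i : ℝ) + 1 := by
      exact_mod_cast h3
    linarith
  · rintro _ ⟨c, ⟨-, hc⟩, rfl⟩
    apply Pi.toLex_monotone
    intro i
    have h2 := (hc i).2
    rw [le_div_iff₀ hpos, mul_comm] at h2
    have h3 : ⌈((N : ℝ) - 1) * x i⌉₊ ≤ c i + 1 := by
      rw [Nat.ceil_le]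
      exact_mod_cast h2
    change ⌈((N : ℝ) - 1) * x i⌉₊ - 1 ≤ c i
    omega

/-- The set `R_c(x)` of the vertices of the grid that are corners of the cubelet `R(x)`. A vertex
`v ∈ {0, …, N-1}^d` stands for the point `v/(N-1)` of the cube. -/
noncomputable def corners {d N : ℕ} (x : Fin d → ℝ) : Finset (Fin d → Fin N) :=
  Finset.univ.filter fun v =>
    ∀ i, (v i : ℕ) = cubeletCorner N x i ∨ (v i : ℕ) = cubeletCorner N x i + 1

/-- The set `R_+(x)` of the vertices whose coefficient is positive at `x`. -/
noncomputable def activeVertices {d N : ℕ} (P : (Fin d → Fin N) → (Fin d → ℝ) → ℝ)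
    (x : Fin d → ℝ) : Finset (Fin d → Fin N) :=
  Finset.univ.filter fun v => 0 < P v x

/-- The partial derivative `∂f/∂x_i` of a function on the cube (one-sided at the faces). -/
noncomputable def partialDeriv {d : ℕ} (i : Fin d) (f : (Fin d → ℝ) → ℝ) (x : Fin d → ℝ) : ℝ :=
  fderivWithin ℝ f (unitCube d) x (Pi.single i 1)

/-! ### The machine model

A random access machine with exact real numbers, as a language of structured programs. It has a
memory of natural numbers, a memory of real numbers, indirect addressing in both, and an output
tape. Every elementary instruction and every test takes one step. The arithmetic is restricted to
addition and subtraction, starting from `1`. So a step bound here is one for the usual real RAM;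
moreover on rational inputs a value has grown by at most one factor `2` per step, so that
polynomially many steps are also polynomial time in the bit model. -/

/-- Memory of natural numbers, memory of real numbers, output tape. -/
structure State where
  nat : ℕ → ℕ
  real : ℕ → ℝ
  out : List ℕ

/-- Elementary instructions; `n a` is the natural number in cell `a`, and `r k` is the real number
in cell `k`. -/
inductive Instr where
  /-- `n a := k` -/
  | const (a k : ℕ)
  /-- `n a := n b + n c` -/
  | add (a b c : ℕ)
  /-- `n a := n b - n c`, which is `0` when `n b < n c` -/
  | sub (a b c : ℕ)
  /-- `n a := n (n b)` -/
  | load (a b : ℕ)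
  /-- `n (n a) := n b` -/
  | store (a b : ℕ)
  /-- `r (n a) := 1` -/
  | realOne (a : ℕ)
  /-- `r (n a) := r (n b) + r (n c)` -/
  | realAdd (a b c : ℕ)
  /-- `r (n a) := r (n b) - r (n c)` -/
  | realSub (a b c : ℕ)
  /-- write `n a` at the end of the output tape -/
  | write (a : ℕ)

/-- The effect of one elementary instruction. -/
noncomputable def Instr.exec : Instr → State → State
  | const a k, s => { s with nat := Function.update s.nat a k }
  | add a b c, s => { s with nat := Function.update s.nat a (s.nat b + s.nat c) }
  | sub a b c, s => { s with nat := Function.update s.nat a (s.nat b - s.nat c) }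
  | load a b, s => { s with nat := Function.update s.nat a (s.nat (s.nat b)) }
  | store a b, s => { s with nat := Function.update s.nat (s.nat a) (s.nat b) }
  | realOne a, s => { s with real := Function.update s.real (s.nat a) 1 }
  | realAdd a b c, s =>
      { s with real :=
          Function.update s.real (s.nat a) (s.real (s.nat b) + s.real (s.nat c)) }
  | realSub a b c, s =>
      { s with real :=
          Function.update s.real (s.nat a) (s.real (s.nat b) - s.real (s.nat c)) }
  | write a, s => { s with out := s.out ++ [s.nat a] }

/-- Tests: `n a ≤ n b`, and `r (n a) ≤ r (n b)`. -/
inductive Test where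
  | natLE (a b : ℕ)
  | realLE (a b : ℕ)

/-- The test succeeds in the given state. -/
def Test.Holds : Test → State → Prop
  | natLE a b, s => s.nat a ≤ s.nat b
  | realLE a b, s => s.real (s.nat a) ≤ s.real (s.nat b)

/-- Programs. -/
inductive Program where
  | skip
  | instr (i : Instr)
  | seq (p q : Program)
  | branch (t : Test) (p q : Program)
  | loop (t : Test) (p : Program)

/-- `Runs p s k s'`: started in state `s`, the program `p` halts after `k` steps in state `s'`. -/
inductive Runs : Program → State → ℕ → State → Prop where
  | skip (s : State) : Runs .skip s 0 s
  | instr (i : Instr) (s : State) : Runs (.instr i) s 1 (i.exec s)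
  | seq {p q : Program} {s s' s'' : State} {k l : ℕ} :
      Runs p s k s' → Runs q s' l s'' → Runs (.seq p q) s (k + l) s''
  | branchTrue {t : Test} {p : Program} (q : Program) {s s' : State} {k : ℕ} :
      t.Holds s → Runs p s k s' → Runs (.branch t p q) s (k + 1) s'
  | branchFalse {t : Test} (p : Program) {q : Program} {s s' : State} {k : ℕ} :
      ¬ t.Holds s → Runs q s k s' → Runs (.branch t p q) s (k + 1) s'
  | loopTrue {t : Test} {p : Program} {s s' s'' : State} {k l : ℕ} :
      t.Holds s → Runs p s k s' → Runs (.loop t p) s' l s'' →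
        Runs (.loop t p) s (k + l + 1) s''
  | loopFalse {t : Test} (p : Program) {s : State} :
      ¬ t.Holds s → Runs (.loop t p) s 1 s

/-- The initial state on input `(d, N, x)`: the first two cells of the memory of natural numbers
hold `d` and `N`, the first `d` cells of the memory of real numbers hold `x`, all other cells hold
`0`, and the output tape is empty. -/
noncomputable def initialState {d : ℕ} (N : ℕ) (x : Fin d → ℝ) : State where
  nat k := if k = 0 then d else if k = 1 then N else 0
  real k := if h : k < d then x ⟨k, h⟩ else 0
  out := []

/-- The output tape lists the elements of the finite set `R` of vertices, each one exactly once and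
in some order, a vertex being written as the sequence of its `d` coordinates. -/
def Lists {d N : ℕ} (out : List ℕ) (R : Finset (Fin d → Fin N)) : Prop :=
  ∃ L : List (Fin d → Fin N), L.Nodup ∧ (∀ v, v ∈ L ↔ v ∈ R) ∧
    out = L.flatMap fun v => List.ofFn fun i => (v i : ℕ)

/-- On input `(d, N, x)` the program `A` outputs the set `R` within `T` steps. -/
def Computes {d N : ℕ} (A : Program) (T : ℕ) (x : Fin d → ℝ) (R : Finset (Fin d → Fin N)) : Prop :=
  ∃ k ≤ T, ∃ s : State, Runs A (initialState N x) k s ∧ Lists s.out R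

/-! ### Smooth and efficient interpolation coefficients -/

/-- The functions `P v`, of which only the values on `[0,1]^d` matter, are smooth and efficient
interpolation coefficients, with constant `K` in the derivative bounds, and with the sets `R_+(x)`
being computed by the program `A` within `T` steps. -/
structure IsSEIC {d N : ℕ} (K : ℝ) (A : Program) (T : ℕ)
    (P : (Fin d → Fin N) → (Fin d → ℝ) → ℝ) : Prop where
  /-- (A) smoothness and bounds on the derivatives -/
  contDiffOn : ∀ v, ContDiffOn ℝ 2 (P v) (unitCube d)
  abs_partialDeriv_le : ∀ v, ∀ x ∈ unitCube d, ∀ i,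
    |partialDeriv i (P v) x| ≤ K * ((d : ℝ) ^ 12 / meshSize N)
  abs_partialDeriv_partialDeriv_le : ∀ v, ∀ x ∈ unitCube d, ∀ i l,
    |partialDeriv i (partialDeriv l (P v)) x| ≤ K * ((d : ℝ) ^ 24 / meshSize N ^ 2)
  /-- (B) convex combination -/
  nonneg : ∀ v, ∀ x ∈ unitCube d, 0 ≤ P v x
  sum_eq_one : ∀ x ∈ unitCube d, ∑ v, P v x = 1
  sum_corners_eq_one : ∀ x ∈ unitCube d, ∑ v ∈ corners x, P v x = 1
  /-- (C) sparsity, and efficient computation of the active vertices -/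
  card_le : ∀ x ∈ unitCube d, (activeVertices P x).card ≤ d + 1
  vanish : ∀ x ∈ unitCube d, ∀ v, v ∉ activeVertices P x →
    P v x = 0 ∧ (∀ i, partialDeriv i (P v) x = 0) ∧
      ∀ i l, partialDeriv i (partialDeriv l (P v)) x = 0
  subset_corners : ∀ x ∈ unitCube d, activeVertices P x ⊆ corners x
  computes : ∀ x ∈ unitCube d, Computes A T x (activeVertices P x)
  /-- (D) near a facet of the cube some active vertex lies on that facet -/
  exists_low : ∀ x ∈ unitCube d, ∀ i, x i < 1 / ((N : ℝ) - 1) →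
    ∃ v ∈ activeVertices P x, (v i : ℕ) = 0
  exists_high : ∀ x ∈ unitCube d, ∀ i, 1 - 1 / ((N : ℝ) - 1) < x i →
    ∃ v ∈ activeVertices P x, (v i : ℕ) = N - 1

end SEIC

/-!
The vertex `v` is given a smooth bump function that is positive exactly on the open star of `v` in
Kuhn's triangulation of the grid. With `u = (N - 1) • x - v` and the extra coordinate `u_none = 0`,
this star is `{u_p - u_q < 1 for all p, q}`, so the product of the `(d + 1)²` smooth steps
`σ ((d + 1) (1 - (u_p - u_q)))` does it (`bump_pos_iff`). The formula is the same for all vertices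
and refers to no cubelet, so there is nothing to glue at the faces of cubelets. The coefficients
are the normalized cubes of the bump functions.

* Lower bound for the denominator: the fractional parts of the coordinates of `(N - 1) • x` miss
  one of the `d + 1` intervals `[m/(d+1), (m+1)/(d+1))`. Rounding up the coordinates above the gap
  and rounding down the others gives a vertex whose bump function is `1` at `x`
  (`exists_bump_eq_one`).
* Sparsity: a vertex whose open star contains `x` arises by rounding at a threshold, and the
  threshold may be taken to be `0` or one of the `d` fractional parts (`inStar_iff`).
* Derivatives: the bounds `|f| ≤ 1`, `‖Df‖ ≤ A`, `‖D²f‖ ≤ A²` pass to products with the constants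
  `A` added up (`JetBound.mul`), and similarly to the inverse of the denominator. At a given point
  only `d + 1` of the cubes have a nonzero 2-jet, so everything stays polynomial in `d`. The same
  cubes make the derivatives of a coefficient vanish wherever the coefficient does.
* Algorithm: `listProgram` computes the integer and fractional parts of `(N - 1) • x` by repeated
  addition, and writes one rounding for every distinct threshold (`computes_listProgram`).
-/

namespace SEIC
open Filter Topology

-- Needed for the norm on the space of bilinear maps in which second derivatives live.
set_option maxSynthPendingDepth 3

/-! ### Bounds on 2-jets -/

/-- The function `f` is `C²` at `x`, and its `k`-th derivative at `x` has norm at most `A ^ k` for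
`k ≤ 2`. -/
structure JetBound {E : Type*} [NormedAddCommGroup E] [NormedSpace ℝ E] (A : ℝ) (f : E → ℝ)
    (x : E) : Prop where
  contDiffAt : ContDiffAt ℝ 2 f x
  abs_le : |f x| ≤ 1
  norm_fderiv_le : ‖fderiv ℝ f x‖ ≤ A
  norm_fderiv_fderiv_le : ‖fderiv ℝ (fderiv ℝ f) x‖ ≤ A ^ 2

section Jet
variable {E : Type*} [NormedAddCommGroup E] [NormedSpace ℝ E] {f g : E → ℝ} {x : E} {A B : ℝ}

theorem eventually_differentiableAt (hf : ContDiffAt ℝ 2 f x) :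
    ∀ᶠ y in 𝓝 x, DifferentiableAt ℝ f y :=
  (hf.eventually (by simp)).mono fun _ h => h.differentiableAt (by simp)

theorem differentiableAt_fderiv (hf : ContDiffAt ℝ 2 f x) :
    DifferentiableAt ℝ (fderiv ℝ f) x :=
  (hf.fderiv_right (m := 1) (by norm_num [one_add_one_eq_two])).differentiableAt (by simp)

theorem fderiv_fderiv_mul (hf : ContDiffAt ℝ 2 f x) (hg : ContDiffAt ℝ 2 g x) :
    fderiv ℝ (fderiv ℝ fun y => f y * g y) x =
      (f x • fderiv ℝ (fderiv ℝ g) x + (fderiv ℝ f x).smulRight (fderiv ℝ g x)) +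
      (g x • fderiv ℝ (fderiv ℝ f) x + (fderiv ℝ g x).smulRight (fderiv ℝ f x)) := by
  have h : fderiv ℝ (fun y => f y * g y) =ᶠ[𝓝 x]
      fun y => f y • fderiv ℝ g y + g y • fderiv ℝ f y := by
    filter_upwards [eventually_differentiableAt hf, eventually_differentiableAt hg] with y h1 h2
    exact fderiv_fun_mul h1 h2
  rw [h.fderiv_eq]
  have hf1 := hf.differentiableAt (n := 2) (by simp)
  have hg1 := hg.differentiableAt (n := 2) (by simp)
  have hf2 := differentiableAt_fderiv hf
  have hg2 := differentiableAt_fderiv hg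
  rw [fderiv_fun_add (hf1.fun_smul hg2) (hg1.fun_smul hf2), fderiv_fun_smul hf1 hg2,
    fderiv_fun_smul hg1 hf2]

theorem JetBound.nonneg (hf : JetBound A f x) : 0 ≤ A :=
  (norm_nonneg _).trans hf.norm_fderiv_le

theorem JetBound.mono (hf : JetBound A f x) (h : A ≤ B) : JetBound B f x where
  contDiffAt := hf.contDiffAt
  abs_le := hf.abs_le
  norm_fderiv_le := hf.norm_fderiv_le.trans h
  norm_fderiv_fderiv_le := hf.norm_fderiv_fderiv_le.trans (by gcongr; exact hf.nonneg)

/-- The constants add up because `A ^ 2 + 2 * A * B + B ^ 2 = (A + B) ^ 2`. -/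
theorem JetBound.mul (hf : JetBound A f x) (hg : JetBound B g x) :
    JetBound (A + B) (fun y => f y * g y) x where
  contDiffAt := hf.contDiffAt.mul hg.contDiffAt
  abs_le := by
    rw [abs_mul]
    exact mul_le_one₀ hf.abs_le (abs_nonneg _) hg.abs_le
  norm_fderiv_le := by
    rw [fderiv_fun_mul (hf.contDiffAt.differentiableAt (by simp))
      (hg.contDiffAt.differentiableAt (by simp))]
    have h1 : ‖f x • fderiv ℝ g x‖ ≤ 1 * B := by
      rw [norm_smul]
      exact mul_le_mul hf.abs_le hg.norm_fderiv_le (norm_nonneg _) zero_le_one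
    have h2 : ‖g x • fderiv ℝ f x‖ ≤ 1 * A := by
      rw [norm_smul]
      exact mul_le_mul hg.abs_le hf.norm_fderiv_le (norm_nonneg _) zero_le_one
    linarith [norm_add_le (f x • fderiv ℝ g x) (g x • fderiv ℝ f x)]
  norm_fderiv_fderiv_le := by
    rw [fderiv_fderiv_mul hf.contDiffAt hg.contDiffAt]
    have h1 : ‖f x • fderiv ℝ (fderiv ℝ g) x‖ ≤ 1 * B ^ 2 := by
      rw [norm_smul]
      exact mul_le_mul hf.abs_le hg.norm_fderiv_fderiv_le (norm_nonneg _) zero_le_one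
    have h2 : ‖g x • fderiv ℝ (fderiv ℝ f) x‖ ≤ 1 * A ^ 2 := by
      rw [norm_smul]
      exact mul_le_mul hg.abs_le hf.norm_fderiv_fderiv_le (norm_nonneg _) zero_le_one
    have h3 : ‖(fderiv ℝ f x).smulRight (fderiv ℝ g x)‖ ≤ A * B := by
      rw [ContinuousLinearMap.norm_smulRight_apply]
      exact mul_le_mul hf.norm_fderiv_le hg.norm_fderiv_le (norm_nonneg _) hf.nonneg
    have h4 : ‖(fderiv ℝ g x).smulRight (fderiv ℝ f x)‖ ≤ B * A := by
      rw [ContinuousLinearMap.norm_smulRight_apply]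
      exact mul_le_mul hg.norm_fderiv_le hf.norm_fderiv_le (norm_nonneg _) hg.nonneg
    refine (norm_add_le _ _).trans ((add_le_add (norm_add_le _ _) (norm_add_le _ _)).trans ?_)
    linarith

theorem JetBound.prod {ι : Type*} {s : Finset ι} {f : ι → E → ℝ}
    (hf : ∀ i ∈ s, JetBound A (f i) x) :
    JetBound (s.card * A) (fun y => ∏ i ∈ s, f i y) x := by
  classical
  induction s using Finset.induction_on with
  | empty =>
    have h : fderiv ℝ (fun _ : E => (1 : ℝ)) = fun _ => 0 := by
      ext1 y
      simp
    refine ⟨by simpa using contDiffAt_const, by simp, by simp, ?_⟩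
    rw [show (fun y : E => ∏ i ∈ (∅ : Finset ι), f i y) = fun _ => 1 by simp, h]
    simp
  | insert a s ha ih =>
    simp only [Finset.prod_insert ha, Finset.card_insert_of_notMem ha]
    refine ((hf a (by simp)).mul (ih fun i hi => hf i (by simp [hi]))).mono (le_of_eq ?_)
    push_cast
    ring

theorem JetBound.pow_three (hf : JetBound A f x) : JetBound (3 * A) (fun y => f y ^ 3) x := by
  have h := (hf.mul hf).mul hf
  have h' : (fun y => f y * f y * f y) = fun y => f y ^ 3 := by
    ext y
    ring
  rw [h'] at h
  exact h.mono (by linarith)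

/-- At a zero of `f`, the product of `f ^ 3` with any other function vanishes to second order. -/
theorem fderiv_pow_three_mul_eq_zero (hf : ContDiffAt ℝ 2 f x) (hg : ContDiffAt ℝ 2 g x)
    (h : f x = 0) : fderiv ℝ (fun y => f y ^ 3 * g y) x = 0 ∧
      fderiv ℝ (fderiv ℝ fun y => f y ^ 3 * g y) x = 0 := by
  have e : (fun y => f y ^ 3 * g y) = fun y => f y * (f y * (f y * g y)) := by
    ext y
    ring
  have d1 : ∀ {u : E → ℝ}, ContDiffAt ℝ 2 u x → fderiv ℝ (fun y => f y * u y) x =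
      f x • fderiv ℝ u x + u x • fderiv ℝ f x := fun hu =>
    fderiv_fun_mul (hf.differentiableAt (by simp)) (hu.differentiableAt (by simp))
  rw [e, d1 (hf.mul (hf.mul hg)), fderiv_fderiv_mul hf (hf.mul (hf.mul hg)),
    d1 (hf.mul hg)]
  constructor
  · simp [h]
  · ext u w
    simp [h]

theorem fderiv_inv_eq {S : E → ℝ} (hS : DifferentiableAt ℝ S x) (h0 : S x ≠ 0) :
    fderiv ℝ (fun y => (S y)⁻¹) x = -((S x)⁻¹ * (S x)⁻¹) • fderiv ℝ S x := by
  have h := ((hasDerivAt_inv h0).comp_hasFDerivAt x hS.hasFDerivAt).fderiv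
  rw [show (fun y => (S y)⁻¹) = Inv.inv ∘ S from rfl, h]
  congr 1
  rw [neg_inj, pow_two, mul_inv]

/-- Follows from `D(1/S) = -S⁻² DS`, with `|S⁻¹| ≤ 1` and
`‖D²(1/S)‖ ≤ ‖D²S‖ + 2 ‖DS‖² ≤ 3 A²`. -/
theorem JetBound.inv {S : E → ℝ} (hS : ContDiffAt ℝ 2 S x) (h1 : 1 ≤ S x)
    (hd : ‖fderiv ℝ S x‖ ≤ A) (hdd : ‖fderiv ℝ (fderiv ℝ S) x‖ ≤ A ^ 2) :
    JetBound (2 * A) (fun y => (S y)⁻¹) x := by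
  have hA : 0 ≤ A := (norm_nonneg _).trans hd
  have h0 : S x ≠ 0 := by positivity
  have hSd := hS.differentiableAt (n := 2) (by simp)
  have hinv : ContDiffAt ℝ 2 (fun y => (S y)⁻¹) x := hS.inv h0
  have hle : |(S x)⁻¹| ≤ 1 := by
    rw [abs_of_pos (by positivity)]
    exact inv_le_one_of_one_le₀ h1
  have hle2 : |(S x)⁻¹ * (S x)⁻¹| ≤ 1 := by
    rw [abs_mul]
    exact mul_le_one₀ hle (abs_nonneg _) hle
  have hD : ‖fderiv ℝ (fun y => (S y)⁻¹) x‖ ≤ A := by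
    rw [fderiv_inv_eq hSd h0, norm_smul, norm_neg]
    calc _ ≤ 1 * A := mul_le_mul hle2 hd (norm_nonneg _) zero_le_one
      _ = A := one_mul A
  refine ⟨hinv, hle, hD.trans (by linarith), ?_⟩
  have hev : fderiv ℝ (fun y => (S y)⁻¹) =ᶠ[𝓝 x]
      fun y => (-((S y)⁻¹ * (S y)⁻¹)) • fderiv ℝ S y := by
    filter_upwards [eventually_differentiableAt hS, hS.continuousAt.eventually_ne h0] with y h2 h3
    exact fderiv_inv_eq h2 h3
  have hinvd := hinv.differentiableAt (n := 2) (by simp)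
  have hc : DifferentiableAt ℝ (fun y => -((S y)⁻¹ * (S y)⁻¹)) x := (hinvd.mul hinvd).neg
  rw [hev.fderiv_eq, fderiv_fun_smul hc (differentiableAt_fderiv hS), fderiv_fun_neg,
    fderiv_fun_mul hinvd hinvd]
  have hB : ‖-((S x)⁻¹ • fderiv ℝ (fun y => (S y)⁻¹) x +
      (S x)⁻¹ • fderiv ℝ (fun y => (S y)⁻¹) x)‖ ≤ 2 * A := by
    rw [norm_neg]
    have h4 : ‖(S x)⁻¹ • fderiv ℝ (fun y => (S y)⁻¹) x‖ ≤ 1 * A := by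
      rw [norm_smul]
      exact mul_le_mul hle hD (norm_nonneg _) zero_le_one
    linarith [norm_add_le ((S x)⁻¹ • fderiv ℝ (fun y => (S y)⁻¹) x)
      ((S x)⁻¹ • fderiv ℝ (fun y => (S y)⁻¹) x)]
  have h5 : ‖-((S x)⁻¹ * (S x)⁻¹) • fderiv ℝ (fderiv ℝ S) x‖ ≤ 1 * A ^ 2 := by
    rw [norm_smul, norm_neg]
    exact mul_le_mul hle2 hdd (norm_nonneg _) zero_le_one
  refine (norm_add_le _ _).trans ?_
  rw [ContinuousLinearMap.norm_smulRight_apply]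
  have h6 := mul_le_mul hB hd (norm_nonneg _) (by linarith)
  nlinarith

end Jet

/-! ### The smooth step -/

theorem exists_bound_deriv_smoothTransition :
    ∃ C : ℝ, 1 ≤ C ∧ (∀ y, |deriv Real.smoothTransition y| ≤ C) ∧
      ∀ y, |deriv (deriv Real.smoothTransition) y| ≤ C := by
  have hs : ContDiff ℝ 2 Real.smoothTransition := Real.smoothTransition.contDiff
  have hs1 : ContDiff ℝ 1 (deriv Real.smoothTransition) :=
    ((contDiff_succ_iff_deriv (n := 1)).1 (by simpa [one_add_one_eq_two] using hs)).2.2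
  have hc : HasCompactSupport (deriv Real.smoothTransition) := by
    refine HasCompactSupport.intro (isCompact_Icc (a := (0 : ℝ)) (b := 1)) fun y hy => ?_
    rw [Set.mem_Icc, not_and_or, not_le, not_le] at hy
    rcases hy with hy | hy
    · have : Real.smoothTransition =ᶠ[𝓝 y] fun _ => 0 :=
        (eventually_lt_nhds hy).mono fun z hz => Real.smoothTransition.zero_of_nonpos hz.le
      simp [this.deriv_eq]
    · have : Real.smoothTransition =ᶠ[𝓝 y] fun _ => 1 :=
        (eventually_gt_nhds hy).mono fun z hz => Real.smoothTransition.one_of_one_le hz.le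
      simp [this.deriv_eq]
  obtain ⟨C₁, h₁⟩ := hs1.continuous.bounded_above_of_compact_support hc
  obtain ⟨C₂, h₂⟩ := (hs1.continuous_deriv le_rfl).bounded_above_of_compact_support hc.deriv
  exact ⟨max 1 (max C₁ C₂), le_max_left _ _, fun y => (h₁ y).trans (by simp),
    fun y => (h₂ y).trans (by simp)⟩

theorem JetBound.smoothTransition_affine {E : Type*} [NormedAddCommGroup E] [NormedSpace ℝ E]
    {C : ℝ} (hC : 1 ≤ C) (h₁ : ∀ y, |deriv Real.smoothTransition y| ≤ C)
    (h₂ : ∀ y, |deriv (deriv Real.smoothTransition) y| ≤ C) (ℓ : E →L[ℝ] ℝ) (b : ℝ) (x : E) :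
    JetBound (C * ‖ℓ‖) (fun y => Real.smoothTransition (ℓ y + b)) x := by
  have hs : ContDiff ℝ 2 Real.smoothTransition := Real.smoothTransition.contDiff
  have hs1 : ContDiff ℝ 1 (deriv Real.smoothTransition) :=
    ((contDiff_succ_iff_deriv (n := 1)).1 (by simpa [one_add_one_eq_two] using hs)).2.2
  have hℓ : ∀ y, HasFDerivAt (fun z => ℓ z + b) ℓ y := fun y => ℓ.hasFDerivAt.add_const b
  have hd : fderiv ℝ (fun y => Real.smoothTransition (ℓ y + b)) =
      fun y => deriv Real.smoothTransition (ℓ y + b) • ℓ := by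
    ext1 y
    exact ((hs.differentiable (by simp) _).hasDerivAt.comp_hasFDerivAt y (hℓ y)).fderiv
  have hdd : fderiv ℝ (fun y => deriv Real.smoothTransition (ℓ y + b) • ℓ) x =
      (deriv (deriv Real.smoothTransition) (ℓ x + b) • ℓ).smulRight ℓ :=
    (((hs1.differentiable (by simp) _).hasDerivAt.comp_hasFDerivAt x (hℓ x)).smul_const ℓ).fderiv
  refine ⟨(hs.comp (ℓ.contDiff.add contDiff_const)).contDiffAt, ?_, ?_, ?_⟩
  · rw [abs_of_nonneg (Real.smoothTransition.nonneg _)]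
    exact Real.smoothTransition.le_one _
  · rw [hd, norm_smul]
    exact mul_le_mul_of_nonneg_right (h₁ _) (norm_nonneg _)
  · rw [hd, hdd, ContinuousLinearMap.norm_smulRight_apply, norm_smul]
    have h3 := h₂ (ℓ x + b)
    rw [← Real.norm_eq_abs] at h3
    calc _ ≤ C * ‖ℓ‖ * ‖ℓ‖ := by gcongr
      _ ≤ C * ‖ℓ‖ * (C * ‖ℓ‖) := by
        gcongr
        exact le_mul_of_one_le_left (norm_nonneg _) hC
      _ = _ := by ring

/-! ### Partial derivatives on the cube -/

theorem uniqueDiffOn_unitCube (d : ℕ) : UniqueDiffOn ℝ (unitCube d) := by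
  rw [unitCube, ← Set.pi_univ_Icc]
  exact UniqueDiffOn.univ_pi fun i => uniqueDiffOn_Icc zero_lt_one

theorem partialDeriv_eq {d : ℕ} {f : (Fin d → ℝ) → ℝ} {x : Fin d → ℝ} (hx : x ∈ unitCube d)
    (hf : DifferentiableAt ℝ f x) (i : Fin d) :
    partialDeriv i f x = fderiv ℝ f x (Pi.single i 1) := by
  rw [partialDeriv, hf.fderivWithin (uniqueDiffOn_unitCube d x hx)]

theorem partialDeriv_partialDeriv_eq {d : ℕ} {f : (Fin d → ℝ) → ℝ}
    (hf : ∀ y ∈ unitCube d, ContDiffAt ℝ 2 f y) {x : Fin d → ℝ} (hx : x ∈ unitCube d)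
    (i l : Fin d) : partialDeriv i (partialDeriv l f) x =
      fderiv ℝ (fderiv ℝ f) x (Pi.single i 1) (Pi.single l 1) := by
  have h : Set.EqOn (partialDeriv l f) (fun y => fderiv ℝ f y (Pi.single l 1)) (unitCube d) :=
    fun y hy => partialDeriv_eq hy ((hf y hy).differentiableAt (by simp)) l
  have h2 := (differentiableAt_fderiv (hf x hx)).clm_apply
    (differentiableAt_const (Pi.single l (1 : ℝ)))
  rw [partialDeriv, fderivWithin_congr h (h hx), h2.fderivWithin (uniqueDiffOn_unitCube d x hx),
    fderiv_clm_apply (differentiableAt_fderiv (hf x hx)) (differentiableAt_const _)]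
  simp

/-! ### Bump functions on the stars of the Kuhn triangulation -/

/-- The coordinates of `(N - 1) • x - v`, extended by a coordinate `0` at the index `none`. -/
noncomputable def offset {d N : ℕ} (v : Fin d → Fin N) (x : Fin d → ℝ) : Option (Fin d) → ℝ
  | none => 0
  | some i => ((N : ℝ) - 1) * x i - (v i : ℕ)

/-- The point `x` lies in the open star of the vertex `v` in Kuhn's triangulation of the grid:
any two coordinates of `offset v x` differ by less than `1`. -/
def InStar {d N : ℕ} (v : Fin d → Fin N) (x : Fin d → ℝ) : Prop :=
  ∀ p q, offset v x p - offset v x q < 1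

/-- A smooth function that is positive exactly on the open star of `v`. -/
noncomputable def bump {d N : ℕ} (v : Fin d → Fin N) (x : Fin d → ℝ) : ℝ :=
  ∏ p : Option (Fin d) × Option (Fin d),
    Real.smoothTransition (((d : ℝ) + 1) * (1 - (offset v x p.1 - offset v x p.2)))

/-- The sum of the cubes of the bump functions. -/
noncomputable def bumpSum (d N : ℕ) (x : Fin d → ℝ) : ℝ :=
  ∑ w : Fin d → Fin N, bump w x ^ 3

/-- The interpolation coefficients: normalized cubes of the bump functions. The exponent makes all
derivatives up to order two vanish where the bump function does. -/
noncomputable def coeff {d N : ℕ} (v : Fin d → Fin N) (x : Fin d → ℝ) : ℝ :=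
  bump v x ^ 3 * (bumpSum d N x)⁻¹

section
variable {d N : ℕ} {v : Fin d → Fin N} {x : Fin d → ℝ}

theorem bump_nonneg (v : Fin d → Fin N) (x : Fin d → ℝ) : 0 ≤ bump v x :=
  Finset.prod_nonneg fun _ _ => Real.smoothTransition.nonneg _

theorem bump_pos_iff : 0 < bump v x ↔ InStar v x := by
  have hd : (0 : ℝ) < (d : ℝ) + 1 := by positivity
  constructor
  · intro h p q
    by_contra! hpq
    refine h.ne' (Finset.prod_eq_zero (Finset.mem_univ (p, q)) ?_)
    exact Real.smoothTransition.zero_of_nonpos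
      (mul_nonpos_of_nonneg_of_nonpos hd.le (by simp only; linarith))
  · intro h
    refine Finset.prod_pos fun p _ => Real.smoothTransition.pos_of_pos (mul_pos hd ?_)
    linarith [h p.1 p.2]

theorem bump_eq_one (h : ∀ p q, offset v x p - offset v x q ≤ (d : ℝ) / (d + 1)) :
    bump v x = 1 := by
  have hd : (0 : ℝ) < (d : ℝ) + 1 := by positivity
  refine Finset.prod_eq_one fun p _ => Real.smoothTransition.one_of_one_le ?_
  have := mul_le_mul_of_nonneg_left (h p.1 p.2) hd.le
  rw [mul_div_cancel₀ _ hd.ne'] at this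
  linarith

/-! ### Rounding at a threshold -/

/-- The integer part of the `k`-th coordinate of `(N - 1) • x`, and `0` for `k ≥ d`. -/
noncomputable def base (N : ℕ) (x : Fin d → ℝ) (k : ℕ) : ℕ :=
  if h : k < d then ⌊((N : ℝ) - 1) * x ⟨k, h⟩⌋₊ else 0

/-- The fractional part of the `k`-th coordinate of `(N - 1) • x`, and `0` for `k ≥ d`. -/
noncomputable def level (N : ℕ) (x : Fin d → ℝ) (k : ℕ) : ℝ :=
  if h : k < d then ((N : ℝ) - 1) * x ⟨k, h⟩ - ⌊((N : ℝ) - 1) * x ⟨k, h⟩⌋₊ else 0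

open Classical in
/-- The `k`-th coordinate of `(N - 1) • x`, rounded up if its fractional part exceeds `s`, and
rounded down otherwise. -/
noncomputable def roundAt (N : ℕ) (x : Fin d → ℝ) (s : ℝ) (k : ℕ) : ℕ :=
  base N x k + if s < level N x k then 1 else 0

theorem base_add_level (i : Fin d) :
    (base N x i : ℝ) + level N x i = ((N : ℝ) - 1) * x i := by
  simp [base, level]

theorem level_lt_one (k : ℕ) : level N x k < 1 := by
  unfold level
  split_ifs with h
  · linarith [Nat.lt_floor_add_one (((N : ℝ) - 1) * x ⟨k, h⟩)]
  · exact zero_lt_one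

theorem level_self : level N x d = 0 := by simp [level]

theorem sub_one_pos (hN : 2 ≤ N) : (0 : ℝ) < (N : ℝ) - 1 := by
  have : (2 : ℝ) ≤ N := by exact_mod_cast hN
  linarith

theorem scaled_nonneg (hN : 2 ≤ N) (hx : x ∈ unitCube d) (i : Fin d) :
    0 ≤ ((N : ℝ) - 1) * x i :=
  mul_nonneg (sub_one_pos hN).le (hx.1 i)

theorem level_nonneg (hN : 2 ≤ N) (hx : x ∈ unitCube d) (k : ℕ) : 0 ≤ level N x k := by
  unfold level
  split_ifs with h
  · linarith [Nat.floor_le (scaled_nonneg hN hx ⟨k, h⟩)]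
  · exact le_rfl

theorem roundAt_lt (hN : 2 ≤ N) (hx : x ∈ unitCube d) {s : ℝ} (hs : 0 ≤ s) (i : Fin d) :
    roundAt N x s i < N := by
  have h1 := base_add_level (N := N) (x := x) i
  have h2 : ((N : ℝ) - 1) * x i ≤ (N : ℝ) - 1 :=
    mul_le_of_le_one_right (sub_one_pos hN).le (hx.2 i)
  unfold roundAt
  split_ifs with h
  · have : ((base N x i + 1 : ℕ) : ℝ) < N := by
      push_cast
      linarith
    exact_mod_cast this
  · have : ((base N x i : ℕ) : ℝ) < N := by
      linarith [level_nonneg hN hx (i : ℕ)]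
    exact_mod_cast this

theorem offset_of_eq_roundAt {s : ℝ} (hv : ∀ i, (v i : ℕ) = roundAt N x s i) (i : Fin d) :
    (s < level N x i ∧ offset v x (some i) = level N x i - 1) ∨
      (level N x i ≤ s ∧ offset v x (some i) = level N x i) := by
  have h1 := base_add_level (N := N) (x := x) i
  rw [offset, hv i, roundAt, ← h1]
  split_ifs with h
  · left
    refine ⟨h, ?_⟩
    push_cast
    ring
  · right
    refine ⟨not_lt.1 h, ?_⟩
    push_cast
    ring

theorem inStar_of_eq_roundAt {s : ℝ} (hN : 2 ≤ N) (hx : x ∈ unitCube d) (hs : 0 ≤ s)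
    (hs' : s < 1) (hv : ∀ i, (v i : ℕ) = roundAt N x s i) : InStar v x := by
  have key : ∀ p, s - 1 < offset v x p ∧ offset v x p ≤ s := by
    rintro (_ | i)
    · simp only [offset]
      constructor <;> linarith
    · have h1 := level_lt_one (N := N) (x := x) (i : ℕ)
      have h2 := level_nonneg hN hx (i : ℕ)
      rcases offset_of_eq_roundAt hv i with ⟨h3, h4⟩ | ⟨h3, h4⟩ <;> rw [h4] <;>
        constructor <;> linarith
  intro p q
  linarith [(key p).2, (key q).1]

theorem abs_lt_of_inStar (h : InStar v x) (i : Fin d) :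
    ((N : ℝ) - 1) * x i < (v i : ℕ) + 1 ∧ ((v i : ℕ) : ℝ) < ((N : ℝ) - 1) * x i + 1 := by
  have h1 := h (some i) none
  have h2 := h none (some i)
  simp only [offset] at h1 h2
  constructor <;> linarith

/-- The vertices whose open star contains `x` are the roundings of `x` at the thresholds `0` and
`level N x k`. -/
theorem inStar_iff (hN : 2 ≤ N) (hx : x ∈ unitCube d) :
    InStar v x ↔ ∃ k ≤ d, ∀ i, (v i : ℕ) = roundAt N x (level N x k) i := by
  constructor
  swap
  · rintro ⟨k, -, hk⟩
    exact inStar_of_eq_roundAt hN hx (level_nonneg hN hx k) (level_lt_one k) hk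
  intro h
  have hcase : ∀ i, (v i : ℕ) = base N x i ∨ (v i : ℕ) = base N x i + 1 := by
    intro i
    obtain ⟨h1, h2⟩ := abs_lt_of_inStar h i
    rw [← base_add_level] at h1 h2
    have h3 := level_lt_one (N := N) (x := x) (i : ℕ)
    have h4 := level_nonneg hN hx (i : ℕ)
    have h5 : (base N x i : ℝ) < (v i : ℕ) + 1 := by linarith
    have h6 : ((v i : ℕ) : ℝ) < base N x i + 2 := by linarith
    have h7 : base N x i < (v i : ℕ) + 1 := by exact_mod_cast h5
    have h8 : (v i : ℕ) < base N x i + 2 := by exact_mod_cast h6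
    omega
  classical
  -- The threshold is the largest fractional part among the coordinates that `v` rounds down.
  let D : Finset ℕ := (Finset.range (d + 1)).filter fun k =>
    ∀ hk : k < d, (v ⟨k, hk⟩ : ℕ) = base N x k
  obtain ⟨k, hkD, hk⟩ := D.exists_max_image (level N x) ⟨d, by simp [D]⟩
  obtain ⟨hkd, hkv⟩ : k < d + 1 ∧ ∀ hk : k < d, (v ⟨k, hk⟩ : ℕ) = base N x k := by
    simpa [D] using hkD
  have hoff : ∃ p, offset v x p = level N x k := by
    rcases Nat.lt_succ_iff_lt_or_eq.1 hkd with h1 | rfl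
    · refine ⟨some ⟨k, h1⟩, ?_⟩
      have := base_add_level (N := N) (x := x) ⟨k, h1⟩
      rw [offset, hkv h1, ← this]
      simp
    · exact ⟨none, level_self.symm⟩
  obtain ⟨p, hp⟩ := hoff
  refine ⟨k, by omega, fun i => ?_⟩
  by_cases hi : (v i : ℕ) = base N x i
  · have : level N x i ≤ level N x k := hk i (by simp [D, hi])
    rw [roundAt, if_neg (not_lt.2 this), hi, add_zero]
  · have hi' := (hcase i).resolve_left hi
    have h1 := h p (some i)
    rw [hp, offset, hi', ← base_add_level] at h1
    push_cast at h1
    rw [roundAt, if_pos (by linarith), hi']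

/-- By the pigeonhole principle there is a gap of length at least `1 / (d + 1)` between consecutive
fractional parts, and rounding at this gap gives the vertex. -/
theorem exists_bump_eq_one (hN : 2 ≤ N) (hx : x ∈ unitCube d) :
    ∃ v : Fin d → Fin N, bump v x = 1 := by
  have hd : (0 : ℝ) < (d : ℝ) + 1 := by positivity
  -- One of the `d + 1` intervals `[m/(d+1), (m+1)/(d+1))` contains no fractional part.
  obtain ⟨m, hm, hmi⟩ : ∃ m < d + 1, ∀ i : Fin d, ⌊((d : ℝ) + 1) * level N x i⌋₊ ≠ m := by
    by_contra! hcon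
    have hsub : Finset.range (d + 1) ⊆
        Finset.univ.image fun i : Fin d => ⌊((d : ℝ) + 1) * level N x i⌋₊ := by
      intro m hm
      simpa using hcon m (Finset.mem_range.1 hm)
    have := (Finset.card_le_card hsub).trans Finset.card_image_le
    simp at this
  have hs0 : (0 : ℝ) ≤ m / (d + 1) := by positivity
  refine ⟨fun i => ⟨roundAt N x (m / (d + 1)) i, roundAt_lt hN hx hs0 i⟩, bump_eq_one ?_⟩
  have hmd : (m : ℝ) ≤ d := by exact_mod_cast Nat.lt_succ_iff.1 hm
  have key : ∀ p, ((m : ℝ) + 1) / (d + 1) - 1 ≤ offset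
      (fun i => (⟨roundAt N x (m / (d + 1)) i, roundAt_lt hN hx hs0 i⟩ : Fin N)) x p ∧ offset
      (fun i => (⟨roundAt N x (m / (d + 1)) i, roundAt_lt hN hx hs0 i⟩ : Fin N)) x p ≤
        m / (d + 1) := by
    have h5 : ((m : ℝ) + 1) / (d + 1) ≤ 1 := by
      rw [div_le_one hd]
      linarith
    rintro (_ | i)
    · simp only [offset]
      exact ⟨by linarith, hs0⟩
    · have h1 := level_lt_one (N := N) (x := x) (i : ℕ)
      have h2 := level_nonneg hN hx (i : ℕ)
      rcases offset_of_eq_roundAt (N := N) (x := x) (s := m / (d + 1))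
        (v := fun i => ⟨roundAt N x (m / (d + 1)) i, roundAt_lt hN hx hs0 i⟩)
        (fun _ => rfl) i with ⟨h3, h4⟩ | ⟨h3, h4⟩ <;> rw [h4]
      · have h6 : ((m : ℝ) + 1) / (d + 1) ≤ level N x i := by
          rw [div_le_iff₀' hd]
          rw [div_lt_iff₀' hd] at h3
          have h7 : m ≤ ⌊((d : ℝ) + 1) * level N x i⌋₊ := Nat.le_floor h3.le
          have h8 : m + 1 ≤ ⌊((d : ℝ) + 1) * level N x i⌋₊ := by
            have := hmi i
            omega
          have h9 := Nat.floor_le (mul_nonneg hd.le h2)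
          have h10 : ((m : ℝ) + 1) ≤ ⌊((d : ℝ) + 1) * level N x i⌋₊ := by exact_mod_cast h8
          linarith
        constructor <;> linarith
      · exact ⟨by linarith, h3⟩
  intro p q
  have h1 : (d : ℝ) / (d + 1) = m / (d + 1) - ((m + 1) / (d + 1) - 1) := by
    field_simp
    ring
  rw [h1]
  linarith [(key p).2, (key q).1]

theorem one_le_bumpSum (hN : 2 ≤ N) (hx : x ∈ unitCube d) : 1 ≤ bumpSum d N x := by
  obtain ⟨v, hv⟩ := exists_bump_eq_one hN hx
  have := Finset.single_le_sum (f := fun w : Fin d → Fin N => bump w x ^ 3)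
    (fun w _ => pow_nonneg (bump_nonneg w x) 3) (Finset.mem_univ v)
  simpa [bumpSum, hv] using this

theorem coeff_nonneg (hN : 2 ≤ N) (hx : x ∈ unitCube d) (v : Fin d → Fin N) : 0 ≤ coeff v x :=
  mul_nonneg (pow_nonneg (bump_nonneg v x) 3)
    (inv_nonneg.2 (zero_le_one.trans (one_le_bumpSum hN hx)))

theorem mem_activeVertices_iff (hN : 2 ≤ N) (hx : x ∈ unitCube d) :
    v ∈ activeVertices coeff x ↔ InStar v x := by
  have hS : 0 < (bumpSum d N x)⁻¹ := inv_pos.2 (zero_lt_one.trans_le (one_le_bumpSum hN hx))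
  rw [activeVertices, Finset.mem_filter, ← bump_pos_iff, coeff, mul_pos_iff_of_pos_right hS]
  simp [Odd.pow_pos_iff (by decide : Odd 3)]

theorem bump_eq_zero (h : ¬ InStar v x) : bump v x = 0 := by
  rw [← bump_pos_iff] at h
  exact le_antisymm (not_lt.1 h) (bump_nonneg v x)

theorem sum_coeff (hN : 2 ≤ N) (hx : x ∈ unitCube d) :
    ∑ v : Fin d → Fin N, coeff v x = 1 := by
  simp only [coeff]
  rw [← Finset.sum_mul]
  exact mul_inv_cancel₀ (zero_lt_one.trans_le (one_le_bumpSum hN hx)).ne'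

theorem mem_corners_of_inStar (hN : 2 ≤ N) (hx : x ∈ unitCube d) (h : InStar v x) :
    v ∈ corners x := by
  rw [corners, Finset.mem_filter]
  refine ⟨Finset.mem_univ v, fun i => ?_⟩
  rw [cubeletCorner]
  obtain ⟨h1, h2⟩ := abs_lt_of_inStar h i
  have h3 := Nat.le_ceil (((N : ℝ) - 1) * x i)
  have h4 := Nat.ceil_lt_add_one (scaled_nonneg hN hx i)
  have h5 : ((v i : ℕ) : ℝ) < ⌈((N : ℝ) - 1) * x i⌉₊ + 1 := by linarith
  have h6 : (⌈((N : ℝ) - 1) * x i⌉₊ : ℝ) < (v i : ℕ) + 2 := by linarith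
  have h7 : (v i : ℕ) < ⌈((N : ℝ) - 1) * x i⌉₊ + 1 := by exact_mod_cast h5
  have h8 : ⌈((N : ℝ) - 1) * x i⌉₊ < (v i : ℕ) + 2 := by exact_mod_cast h6
  omega

theorem activeVertices_subset_corners (hN : 2 ≤ N) (hx : x ∈ unitCube d) :
    activeVertices (coeff (N := N)) x ⊆ corners x :=
  fun _ hv => mem_corners_of_inStar hN hx ((mem_activeVertices_iff hN hx).1 hv)

theorem sum_corners_coeff (hN : 2 ≤ N) (hx : x ∈ unitCube d) :
    ∑ v ∈ corners x, coeff (N := N) v x = 1 := by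
  rw [← sum_coeff (N := N) hN hx]
  refine Finset.sum_subset (Finset.subset_univ _) fun v _ hv => ?_
  rw [coeff, bump_eq_zero fun h => hv (mem_corners_of_inStar hN hx h)]
  simp

theorem card_activeVertices_le (hN : 2 ≤ N) (hx : x ∈ unitCube d) :
    (activeVertices (coeff (N := N)) x).card ≤ d + 1 := by
  have h : ∀ v : Fin d → Fin N, ∃ k, v ∈ activeVertices coeff x →
      k ≤ d ∧ ∀ i, (v i : ℕ) = roundAt N x (level N x k) i := by
    intro v
    by_cases hv : v ∈ activeVertices coeff x
    · obtain ⟨k, hk⟩ := (inStar_iff hN hx).1 ((mem_activeVertices_iff hN hx).1 hv)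
      exact ⟨k, fun _ => hk⟩
    · exact ⟨0, fun h => absurd h hv⟩
  choose f hf using h
  rw [← Finset.card_range (d + 1)]
  refine Finset.card_le_card_of_injOn f (fun v hv => ?_) fun v hv w hw hvw => ?_
  · simpa [Nat.lt_succ_iff] using (hf v hv).1
  · ext i
    rw [(hf v hv).2 i, (hf w hw).2 i, hvw]

theorem exists_mem_activeVertices_low (hN : 2 ≤ N) (hx : x ∈ unitCube d) {i : Fin d}
    (hi : x i < 1 / ((N : ℝ) - 1)) :
    ∃ v ∈ activeVertices (coeff (N := N)) x, (v i : ℕ) = 0 := by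
  have hs := level_nonneg hN hx i
  refine ⟨fun j => ⟨roundAt N x (level N x i) j, roundAt_lt hN hx hs j⟩,
    (mem_activeVertices_iff hN hx).2 (inStar_of_eq_roundAt hN hx hs (level_lt_one _) fun _ => rfl),
    ?_⟩
  rw [lt_div_iff₀' (sub_one_pos hN)] at hi
  simp [roundAt, base, hi]

theorem exists_mem_activeVertices_high (hN : 2 ≤ N) (hx : x ∈ unitCube d) {i : Fin d}
    (hi : 1 - 1 / ((N : ℝ) - 1) < x i) :
    ∃ v ∈ activeVertices (coeff (N := N)) x, (v i : ℕ) = N - 1 := by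
  have hlt := roundAt_lt hN hx le_rfl i
  refine ⟨fun j => ⟨roundAt N x 0 j, roundAt_lt hN hx le_rfl j⟩, (mem_activeVertices_iff hN hx).2
    (inStar_of_eq_roundAt hN hx le_rfl zero_lt_one fun _ => rfl), ?_⟩
  have hpos := sub_one_pos hN
  have h1 := mul_lt_mul_of_pos_left hi hpos
  rw [mul_sub, mul_one_div_cancel hpos.ne', ← base_add_level] at h1
  have h2 := level_lt_one (N := N) (x := x) (i : ℕ)
  have h3 : (N : ℝ) < roundAt N x 0 i + 2 := by
    unfold roundAt
    split_ifs with h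
    · push_cast
      linarith
    · push_cast
      linarith
  have h4 : N < roundAt N x 0 i + 2 := by exact_mod_cast h3
  simp only
  omega

/-! ### Bounds on the derivatives of the coefficients -/

theorem jetBound_bump {C : ℝ} (hC : 1 ≤ C) (h₁ : ∀ y, |deriv Real.smoothTransition y| ≤ C)
    (h₂ : ∀ y, |deriv (deriv Real.smoothTransition) y| ≤ C) (hN : 2 ≤ N) (v : Fin d → Fin N)
    (x : Fin d → ℝ) :
    JetBound (2 * C * ((d : ℝ) + 1) ^ 3 * ((N : ℝ) - 1)) (bump v) x := by
  have hpos := sub_one_pos hN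
  let coord : Option (Fin d) → (Fin d → ℝ) →L[ℝ] ℝ := fun p =>
    p.elim 0 fun i => ContinuousLinearMap.proj i
  have hcoord : ∀ p, ‖coord p‖ ≤ 1 := by
    rintro (_ | i)
    · simp [coord]
    · refine ContinuousLinearMap.opNorm_le_bound _ zero_le_one fun y => ?_
      simpa [coord] using norm_le_pi_norm y i
  have hoff : ∀ p y, offset v y p = ((N : ℝ) - 1) * coord p y + offset v 0 p := by
    rintro (_ | i) y
    · simp [coord, offset]
    · simp [coord, offset, sub_eq_add_neg]
  have hfac : ∀ p ∈ (Finset.univ : Finset (Option (Fin d) × Option (Fin d))),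
      JetBound (C * (((d : ℝ) + 1) * ((N : ℝ) - 1) * 2)) (fun y => Real.smoothTransition
        (((d : ℝ) + 1) * (1 - (offset v y p.1 - offset v y p.2)))) x := by
    rintro p -
    have h := JetBound.smoothTransition_affine hC h₁ h₂
      ((((d : ℝ) + 1) * ((N : ℝ) - 1)) • (coord p.2 - coord p.1))
      (((d : ℝ) + 1) * (1 - (offset v 0 p.1 - offset v 0 p.2))) x
    have heq : (fun y => Real.smoothTransition
        (((d : ℝ) + 1) * (1 - (offset v y p.1 - offset v y p.2)))) = fun y =>
        Real.smoothTransition (((((d : ℝ) + 1) * ((N : ℝ) - 1)) • (coord p.2 - coord p.1)) y +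
          ((d : ℝ) + 1) * (1 - (offset v 0 p.1 - offset v 0 p.2))) := by
      ext y
      rw [hoff p.1 y, hoff p.2 y]
      congr 1
      simp only [smul_apply, sub_apply, smul_eq_mul]
      ring
    rw [heq]
    refine h.mono ?_
    rw [norm_smul, Real.norm_of_nonneg (by positivity)]
    have : ‖coord p.2 - coord p.1‖ ≤ 2 := by
      linarith [norm_sub_le (coord p.2) (coord p.1), hcoord p.1, hcoord p.2]
    gcongr
  refine (JetBound.prod hfac).mono (le_of_eq ?_)
  simp
  ring

/-- The constant comes from `3 * A` for `bump v ^ 3` and `2 * (d + 1) * (3 * A)` for the inverse of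
`bumpSum`. -/
theorem jetBound_coeff {A : ℝ} (hN : 2 ≤ N) (hA : ∀ w : Fin d → Fin N, ∀ y, JetBound A (bump w) y)
    (hx : x ∈ unitCube d) (v : Fin d → Fin N) :
    JetBound (3 * (2 * (d : ℝ) + 3) * A) (coeff v) x := by
  have hA0 : 0 ≤ A := (hA v x).nonneg
  have hw := fun w => (hA w x).pow_three
  have hS : ContDiffAt ℝ 2 (bumpSum d N) x :=
    ContDiffAt.sum fun w _ => (hw w).contDiffAt
  have hev : fderiv ℝ (bumpSum d N) =ᶠ[𝓝 x]
      fun y => ∑ w : Fin d → Fin N, fderiv ℝ (fun z => bump w z ^ 3) y := by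
    refine Eventually.of_forall fun y => fderiv_fun_sum fun w _ => ?_
    exact ((hA w y).pow_three).contDiffAt.differentiableAt (by simp)
  -- Only the active vertices, at most `d + 1` of them, give summands that
  -- contribute to the derivatives at `x`.
  have hzero : ∀ w : Fin d → Fin N, w ∉ activeVertices coeff x →
      fderiv ℝ (fun z => bump w z ^ 3) x = 0 ∧
        fderiv ℝ (fderiv ℝ fun z => bump w z ^ 3) x = 0 := by
    intro w hw
    rw [mem_activeVertices_iff hN hx] at hw
    simpa using fderiv_pow_three_mul_eq_zero (hA w x).contDiffAt
      (contDiffAt_const (c := (1 : ℝ))) (bump_eq_zero hw)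
  have hcard : ((activeVertices (coeff (N := N)) x).card : ℝ) ≤ (d : ℝ) + 1 := by
    exact_mod_cast card_activeVertices_le hN hx
  have hd1 : ‖fderiv ℝ (bumpSum d N) x‖ ≤ ((d : ℝ) + 1) * (3 * A) := by
    rw [hev.eq_of_nhds, ← Finset.sum_subset (Finset.subset_univ (activeVertices coeff x))
      fun w _ h => (hzero w h).1]
    refine (norm_sum_le_of_le _ fun w _ => (hw w).norm_fderiv_le).trans ?_
    rw [Finset.sum_const, nsmul_eq_mul]
    gcongr
  have hd2 : ‖fderiv ℝ (fderiv ℝ (bumpSum d N)) x‖ ≤ (((d : ℝ) + 1) * (3 * A)) ^ 2 := by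
    rw [hev.fderiv_eq, fderiv_fun_sum fun w _ => differentiableAt_fderiv (hw w).contDiffAt,
      ← Finset.sum_subset (Finset.subset_univ (activeVertices coeff x))
      fun w _ h => (hzero w h).2]
    refine (norm_sum_le_of_le _ fun w _ => (hw w).norm_fderiv_fderiv_le).trans ?_
    rw [Finset.sum_const, nsmul_eq_mul, mul_pow ((d : ℝ) + 1)]
    have : (d : ℝ) + 1 ≤ ((d : ℝ) + 1) ^ 2 := by nlinarith [Nat.cast_nonneg (α := ℝ) d]
    gcongr
    exact hcard.trans this
  refine ((hw v).mul (JetBound.inv hS (one_le_bumpSum hN hx) hd1 hd2)).mono (le_of_eq ?_)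
  ring

theorem coeff_vanish (hN : 2 ≤ N) (hA : ∀ w : Fin d → Fin N, ∀ y, ContDiffAt ℝ 2 (bump w) y)
    (hx : x ∈ unitCube d) (h : ¬ InStar v x) : coeff v x = 0 ∧ fderiv ℝ (coeff v) x = 0 ∧
      fderiv ℝ (fderiv ℝ (coeff v)) x = 0 := by
  have hS : ContDiffAt ℝ 2 (bumpSum d N) x :=
    ContDiffAt.sum fun w _ => (hA w x).pow 3
  refine ⟨by simp [coeff, bump_eq_zero h], ?_⟩
  exact fderiv_pow_three_mul_eq_zero (hA v x)
    (hS.inv (zero_lt_one.trans_le (one_le_bumpSum hN hx)).ne') (bump_eq_zero h)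

end

/-! ### Reasoning about programs -/

/-- Started in state `s`, the program `p` halts within `T` steps in a state that satisfies `Q`. -/
def HaltsWith (p : Program) (s : State) (T : ℕ) (Q : State → Prop) : Prop :=
  ∃ k ≤ T, ∃ s', Runs p s k s' ∧ Q s'

section Logic
variable {p q : Program} {s : State} {T T' : ℕ} {Q R : State → Prop}

theorem HaltsWith.mono (h : HaltsWith p s T Q) (hT : T ≤ T') (hQ : ∀ s', Q s' → R s') :
    HaltsWith p s T' R := by
  obtain ⟨k, hk, s', hr, hs'⟩ := h
  exact ⟨k, hk.trans hT, s', hr, hQ s' hs'⟩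

theorem HaltsWith.seq (hp : HaltsWith p s T Q) (hq : ∀ s', Q s' → HaltsWith q s' T' R) :
    HaltsWith (.seq p q) s (T + T') R := by
  obtain ⟨k, hk, s', hr, hs'⟩ := hp
  obtain ⟨l, hl, s'', hr', hs''⟩ := hq s' hs'
  exact ⟨k + l, by omega, s'', .seq hr hr', hs''⟩

theorem HaltsWith.branch {t : Test} (hp : t.Holds s → HaltsWith p s T Q)
    (hq : ¬ t.Holds s → HaltsWith q s T Q) : HaltsWith (.branch t p q) s (T + 1) Q := by
  by_cases ht : t.Holds s
  · obtain ⟨k, hk, s', hr, hs'⟩ := hp ht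
    exact ⟨k + 1, by omega, s', .branchTrue q ht hr, hs'⟩
  · obtain ⟨k, hk, s', hr, hs'⟩ := hq ht
    exact ⟨k + 1, by omega, s', .branchFalse p ht hr, hs'⟩

theorem HaltsWith.skip (h : Q s) : HaltsWith .skip s T Q := ⟨0, by omega, s, .skip s, h⟩

/-- Straight-line code. -/
def block : List Instr → Program
  | [] => .skip
  | i :: l => .seq (.instr i) (block l)

theorem HaltsWith.block {l : List Instr} (h : Q (l.foldl (fun s i => i.exec s) s))
    (hT : l.length ≤ T) : HaltsWith (block l) s T Q := by
  suffices HaltsWith (SEIC.block l) s l.length Q from this.mono hT fun _ => id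
  clear hT
  induction l generalizing s with
  | nil => exact .skip h
  | cons i l ih =>
    refine (HaltsWith.seq (T := 1) ⟨1, le_rfl, _, .instr i s, rfl⟩ (T' := l.length) ?_).mono
      (by simp [add_comm]) fun _ => id
    rintro _ rfl
    exact ih h

/-- A loop that runs while the counter in cell `b` is at least `1`; the invariant `I n` holds when
the counter is `n`. -/
theorem HaltsWith.loop {a b : ℕ} {I : ℕ → State → Prop}
    (hI : ∀ n s, I n s → s.nat a = 1 ∧ s.nat b = n)
    (hstep : ∀ n s, I (n + 1) s → HaltsWith p s T (I n)) {n : ℕ} (h : I n s) :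
    HaltsWith (.loop (.natLE a b) p) s (n * (T + 1) + 1) (I 0) := by
  induction n generalizing s with
  | zero =>
    refine ⟨1, by omega, s, .loopFalse p ?_, h⟩
    simp [Test.Holds, hI 0 s h]
  | succ n ih =>
    obtain ⟨k, hk, s', hr, hs'⟩ := hstep n s h
    obtain ⟨l, hl, s'', hr', hs''⟩ := ih hs'
    refine ⟨k + l + 1, ?_, s'', .loopTrue ?_ hr hr', hs''⟩
    · rw [add_mul]
      omega
    · simp [Test.Holds, hI _ s h]

end Logic

/-! ### The program -/

/-- The body of the innermost loop of `scaleProgram`: add the coordinate in real cell `n 3` to the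
accumulator in real cell `n 7`, and carry `1` from the accumulator to `n 5` if possible. -/
def scaleStep : Program :=
  .seq (block [.sub 4 4 2, .realAdd 7 7 3])
    (.branch (.realLE 8 7) (block [.realSub 7 7 8, .add 5 5 2]) .skip)

/-- Decrease `n 3`. Then multiply the coordinate in real cell `n 3` by `N - 1`, leave the
fractional part of the product in that cell, and store the integer part in the array that begins
at cell `n 6`. -/
def scaleProgram : Program :=
  .seq (block [.sub 3 3 2, .realSub 7 7 7, .sub 4 1 2, .const 5 0])
    (.seq (.loop (.natLE 2 4) scaleStep)
      -- Real cell `n 0` holds `0`, so the first instruction copies the accumulator.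
      (block [.realAdd 3 7 0, .add 9 6 3, .store 9 5]))

/-- Set `n 10` to `1` if real cell `n 3` equals some real cell of smaller index, and to `0`
otherwise. -/
def duplicateProgram : Program :=
  .seq (block [.const 10 0, .add 4 3 13])
    (.loop (.natLE 2 4)
      (.seq (block [.sub 4 4 2])
        (.branch (.realLE 3 4) (.branch (.realLE 4 3) (block [.const 10 1]) .skip) .skip)))

/-- Write the vertex obtained by rounding at the threshold in real cell `n 3`. -/
def writeProgram : Program :=
  .seq (block [.add 4 0 13])
    (.loop (.natLE 2 4)
      (.seq (block [.sub 9 0 4, .add 11 6 9, .load 5 11])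
        (.seq (.branch (.realLE 9 3) .skip (block [.add 5 5 2]))
          (block [.write 5, .sub 4 4 2]))))

/-- The program that lists the active vertices: it computes all integer and fractional parts, and
rounds at each threshold that has not occurred among those of smaller index.

Cells of the memory of natural numbers: `0` and `1` hold `d` and `N`; `2`, `6`, `7`, `8` and `13`
hold the constants `1`, `16`, `d + 1`, `d + 2` and `0`; `3` holds the index of the current
coordinate or threshold; `4` is the counter of the inner loops; `5`, `9` and `11` are scratch; `10`
marks duplicates; the cells from `16` on hold the integer parts. Of the real cells, those below `d`
hold the coordinates, later their fractional parts; `d` stays `0` and serves as the additional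
threshold; `d + 1` is an accumulator; `d + 2` holds `1`. -/
def listProgram : Program :=
  .seq (block [.const 2 1, .const 6 16, .add 7 0 2, .add 8 7 2, .realOne 8, .add 3 0 13])
    (.seq (.loop (.natLE 2 3) scaleProgram)
      (.seq (block [.add 3 0 2])
        (.loop (.natLE 2 3)
          (.seq (block [.sub 3 3 2])
            (.seq duplicateProgram (.branch (.natLE 10 13) writeProgram .skip))))))

/-! ### Correctness of the program -/

/-- The cells of the memory of natural numbers that are not used as scratch space. -/
def Kept (a : ℕ) : Prop := a ≤ 2 ∨ 6 ≤ a ∧ a ≤ 8 ∨ 13 ≤ a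

/-- The constants that the program keeps in fixed cells. -/
structure Setup (d N : ℕ) (s : State) : Prop where
  nat0 : s.nat 0 = d
  nat1 : s.nat 1 = N
  nat2 : s.nat 2 = 1
  nat6 : s.nat 6 = 16
  nat7 : s.nat 7 = d + 1
  nat8 : s.nat 8 = d + 2
  nat13 : s.nat 13 = 0
  real_self : s.real d = 0
  real_add_two : s.real (d + 2) = 1

theorem Setup.congr {d N : ℕ} {s s' : State} (h : Setup d N s)
    (hn : ∀ a < 16, Kept a → s'.nat a = s.nat a) (hr : s'.real d = s.real d)
    (hr' : s'.real (d + 2) = s.real (d + 2)) : Setup d N s' := by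
  constructor
  · rw [hn 0 (by omega) (by simp [Kept]), h.nat0]
  · rw [hn 1 (by omega) (by simp [Kept]), h.nat1]
  · rw [hn 2 (by omega) (by simp [Kept]), h.nat2]
  · rw [hn 6 (by omega) (by simp [Kept]), h.nat6]
  · rw [hn 7 (by omega) (by simp [Kept]), h.nat7]
  · rw [hn 8 (by omega) (by simp [Kept]), h.nat8]
  · rw [hn 13 (by omega) (by simp [Kept]), h.nat13]
  · rw [hr, h.real_self]
  · rw [hr', h.real_add_two]

theorem Kept.ne {a : ℕ} (h : Kept a) :
    a ≠ 3 ∧ a ≠ 4 ∧ a ≠ 5 ∧ a ≠ 9 ∧ a ≠ 10 ∧ a ≠ 11 := by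
  unfold Kept at h
  omega

section
variable {d N : ℕ} {x : Fin d → ℝ}

/-- Invariant of the innermost loop of `scaleProgram`: relative to the state `s₀` before the loop,
the accumulator and `n 5` hold the fractional and the integer part of a multiple of `r (n 3)`. -/
structure ScaleInv (d N : ℕ) (i : ℕ) (s₀ : State) (m : ℕ) (s : State) : Prop where
  setup : Setup d N s
  nat3 : s.nat 3 = i
  nat4 : s.nat 4 = m
  kept : ∀ a, Kept a → s.nat a = s₀.nat a
  real : ∀ k, k ≠ d + 1 → s.real k = s₀.real k
  out : s.out = s₀.out
  acc_nonneg : 0 ≤ s.real (d + 1)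
  acc_lt : s.real (d + 1) < 1
  acc : s.real (d + 1) + s.nat 5 = ((N : ℝ) - 1 - m) * s₀.real i

theorem haltsWith_scaleStep {i m : ℕ} {s₀ s : State} (hi : i < d) (h0 : 0 ≤ s₀.real i)
    (h1 : s₀.real i ≤ 1) (h : ScaleInv d N i s₀ (m + 1) s) :
    HaltsWith scaleStep s 5 (ScaleInv d N i s₀ m) := by
  have hS := h.setup
  have hri := h.real i (by omega)
  have hacc := h.acc
  have hnn := h.acc_nonneg
  have hlt := h.acc_lt
  push_cast at hacc
  refine HaltsWith.seq (T := 2) (T' := 3) (Q := fun s' => s' =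
    { s with nat := Function.update s.nat 4 m,
             real := Function.update s.real (d + 1) (s.real (d + 1) + s.real i) })
    (HaltsWith.block ?_ (by simp)) ?_
  · simp [Instr.exec, h.nat4, hS.nat2, hS.nat7, h.nat3]
  rintro _ rfl
  refine HaltsWith.branch (T := 2) (fun ht => HaltsWith.block ?_ (by simp))
    fun ht => HaltsWith.skip ?_
  · simp [Test.Holds, hS.nat7, hS.nat8, hS.real_add_two] at ht
    refine ⟨hS.congr ?_ ?_ ?_, ?_, ?_, ?_, ?_, ?_, ?_, ?_, ?_⟩
    · intro a _ ha
      simp [Instr.exec, ha.ne]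
    · simp [Instr.exec, hS.nat7]
    · simp [Instr.exec, hS.nat7]
    · simp [Instr.exec, h.nat3]
    · simp [Instr.exec]
    · intro a ha
      simp [Instr.exec, ha.ne, h.kept a ha]
    · intro k hk
      simp [Instr.exec, hS.nat7, hk, h.real k hk]
    · simp [Instr.exec, h.out]
    · simp [Instr.exec, hS.nat7, hS.nat8, hS.real_add_two]
      linarith
    · simp [Instr.exec, hS.nat7, hS.nat8, hS.real_add_two]
      linarith
    · simp [Instr.exec, hS.nat7, hS.nat8, hS.real_add_two, hS.nat2]
      linarith
  · simp [Test.Holds, hS.nat7, hS.nat8, hS.real_add_two] at ht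
    refine ⟨hS.congr ?_ ?_ ?_, ?_, ?_, ?_, ?_, ?_, ?_, ?_, ?_⟩
    · intro a _ ha
      simp [ha.ne]
    · simp
    · simp
    · simp [h.nat3]
    · simp
    · intro a ha
      simp [ha.ne, h.kept a ha]
    · intro k hk
      simp [hk, h.real k hk]
    · simp [h.out]
    · simp
      linarith
    · simpa using ht
    · simp
      linarith

/-- Invariant of the loop that computes the integer and fractional parts: the coordinates of index
at least `i` have been treated. -/
structure PrepareInv (N : ℕ) (x : Fin d → ℝ) (i : ℕ) (s : State) : Prop where
  setup : Setup d N s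
  nat3 : s.nat 3 = i
  le : i ≤ d
  todo : ∀ j : Fin d, j < i → s.real j = x j
  real : ∀ j < d, i ≤ j → s.real j = level N x j
  array : ∀ j < d, i ≤ j → s.nat (16 + j) = base N x j
  out : s.out = []

theorem haltsWith_scaleProgram (hN : 2 ≤ N) (hx : x ∈ unitCube d) {i : ℕ} {s : State}
    (h : PrepareInv N x (i + 1) s) :
    HaltsWith scaleProgram s (6 * N + 8) (PrepareInv N x i) := by
  have hS := h.setup
  have hi : i < d := h.le
  have hri : s.real i = x ⟨i, hi⟩ := h.todo ⟨i, hi⟩ (by simp)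
  have hNc : ((N - 1 : ℕ) : ℝ) = (N : ℝ) - 1 := by
    rw [Nat.cast_sub (by omega)]
    simp
  refine (HaltsWith.seq (T := 4) (T' := ((N - 1) * (5 + 1) + 1) + 3)
    (Q := ScaleInv d N i s (N - 1)) (HaltsWith.block ?_ (by simp)) fun s₁ h₁ =>
      HaltsWith.seq (T := (N - 1) * (5 + 1) + 1) (T' := 3) (HaltsWith.loop (I := ScaleInv d N i s)
        (fun n s' h' => ⟨h'.setup.nat2, h'.nat4⟩) (fun m s' h' =>
          haltsWith_scaleStep hi (by rw [hri]; exact hx.1 _) (by rw [hri]; exact hx.2 _) h') h₁)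
        fun s₂ h₂ => HaltsWith.block ?_ (by simp)).mono (by omega) fun _ => id
  · refine ⟨hS.congr ?_ ?_ ?_, ?_, ?_, ?_, ?_, ?_, ?_, ?_, ?_⟩
    · intro a _ ha
      simp [Instr.exec, ha.ne]
    · simp [Instr.exec, hS.nat7]
    · simp [Instr.exec, hS.nat7]
    · simp [Instr.exec, h.nat3, hS.nat2]
    · simp [Instr.exec, hS.nat1, hS.nat2]
    · intro a ha
      simp [Instr.exec, ha.ne]
    · intro k hk
      simp [Instr.exec, hS.nat7, hk]
    · simp [Instr.exec]
    · simp [Instr.exec, hS.nat7]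
    · simp [Instr.exec, hS.nat7]
    · simp [Instr.exec, hS.nat7, hNc]
  · have hS₂ := h₂.setup
    have hacc := h₂.acc
    rw [hri, Nat.cast_zero, sub_zero] at hacc
    have hbase : s₂.nat 5 = base N x i := by
      rw [base, dif_pos hi, eq_comm, Nat.floor_eq_iff (scaled_nonneg hN hx _)]
      constructor <;> linarith [h₂.acc_nonneg, h₂.acc_lt]
    have hlevel : s₂.real (d + 1) = level N x i := by
      have := base_add_level (N := N) (x := x) ⟨i, hi⟩
      simp only at this
      rw [hbase] at hacc
      linarith
    refine ⟨hS₂.congr ?_ ?_ ?_, ?_, hi.le, ?_, ?_, ?_, ?_⟩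
    · intro a ha ha'
      have : a ≠ 16 + i := by omega
      simp [Instr.exec, h₂.nat3, hS₂.nat6, ha'.ne, this]
    · simp [Instr.exec, h₂.nat3, hi.ne']
    · have : d + 2 ≠ i := by omega
      simp [Instr.exec, h₂.nat3, this]
    · have : 3 ≠ 16 + i := by omega
      simp [Instr.exec, h₂.nat3, hS₂.nat6, this]
    · intro j hj
      have h5 : (j : ℕ) ≠ i := by omega
      have h6 : (j : ℕ) ≠ d + 1 := by omega
      simp [Instr.exec, h₂.nat3, h5, h₂.real _ h6, h.todo j (by omega)]
    · intro j hj hij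
      rcases hij.eq_or_lt with rfl | hij
      · simp [Instr.exec, h₂.nat3, hS₂.nat7, hS₂.nat0, hS₂.real_self, hlevel]
      · simp [Instr.exec, h₂.nat3, hij.ne', h₂.real j (by omega), h.real j hj hij]
    · intro j hj hij
      rcases hij.eq_or_lt with rfl | hij
      · simp [Instr.exec, h₂.nat3, hS₂.nat6, hbase]
      · have h5 : 16 + j ≠ 9 := by omega
        have h6 : Kept (16 + j) := by
          unfold Kept
          omega
        simp [Instr.exec, h₂.nat3, hS₂.nat6, hij.ne', h5, h₂.kept _ h6, h.array j hj hij]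
    · simp [Instr.exec, h₂.out, h.out]

/-- All integer and fractional parts have been computed. -/
structure Ready (N : ℕ) (x : Fin d → ℝ) (s : State) : Prop where
  setup : Setup d N s
  real : ∀ k ≤ d, s.real k = level N x k
  array : ∀ j < d, s.nat (16 + j) = base N x j

theorem Ready.congr {s s' : State} (h : Ready N x s) (hn : ∀ a, Kept a → s'.nat a = s.nat a)
    (hr : s'.real = s.real) : Ready N x s' where
  setup := h.setup.congr (fun a _ ha => hn a ha) (by rw [hr]) (by rw [hr])
  real k hk := by rw [hr, h.real k hk]
  array j hj := by
    rw [hn _ (by unfold Kept; omega), h.array j hj]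

open Classical in
theorem haltsWith_duplicateProgram {k : ℕ} {s : State} (hs : Ready N x s) (h3 : s.nat 3 = k)
    (hk : k ≤ d) : HaltsWith duplicateProgram s (5 * k + 3) fun s' => Ready N x s' ∧
      s'.nat 3 = k ∧ s'.out = s.out ∧
        s'.nat 10 = if ∃ l < k, level N x l = level N x k then 1 else 0 := by
  let I : ℕ → State → Prop := fun m s' => Ready N x s' ∧ s'.nat 3 = k ∧ s'.nat 4 = m ∧ m ≤ k ∧
    s'.out = s.out ∧
    s'.nat 10 = if ∃ l < k, m ≤ l ∧ level N x l = level N x k then 1 else 0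
  have hS := hs.setup
  refine (HaltsWith.seq (T := 2) (T' := k * (4 + 1) + 1) (Q := I k)
    (HaltsWith.block ?_ (by simp)) fun s₁ h₁ =>
      (HaltsWith.loop (I := I) (fun n s' h' => ⟨h'.1.setup.nat2, h'.2.2.1⟩) ?_ h₁).mono le_rfl
        ?_).mono (by omega) fun _ => id
  · refine ⟨hs.congr (fun a ha => ?_) ?_, ?_, ?_, le_rfl, ?_, ?_⟩
    · simp [Instr.exec, ha.ne]
    · simp [Instr.exec]
    · simp [Instr.exec, h3]
    · simp [Instr.exec, h3, hS.nat13]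
    · simp [Instr.exec]
    · rw [if_neg (by rintro ⟨l, h5, h6, -⟩; omega)]
      simp [Instr.exec]
  · rintro m s₂ ⟨hR, h3', h4', hmk, hout, h10⟩
    have hex : (∃ l < k, m ≤ l ∧ level N x l = level N x k) ↔ level N x m = level N x k ∨
        ∃ l < k, m + 1 ≤ l ∧ level N x l = level N x k := by
      constructor
      · rintro ⟨l, h5, h6, h7⟩
        rcases h6.eq_or_lt with rfl | h6
        · exact Or.inl h7
        · exact Or.inr ⟨l, h5, h6, h7⟩
      · rintro (h7 | ⟨l, h5, h6, h7⟩)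
        · exact ⟨m, hmk, le_rfl, h7⟩
        · exact ⟨l, h5, by omega, h7⟩
    refine HaltsWith.seq (T := 1) (T' := 3) (Q := fun s' => s' =
      { s₂ with nat := Function.update s₂.nat 4 m }) (HaltsWith.block ?_ (by simp)) ?_
    · simp [Instr.exec, h4', hR.setup.nat2]
    rintro _ rfl
    have hR' : Ready N x { s₂ with nat := Function.update s₂.nat 4 m } :=
      hR.congr (fun a ha => by simp [ha.ne]) rfl
    have hne : level N x m ≠ level N x k →
        I m { s₂ with nat := Function.update s₂.nat 4 m } := by
      intro hne
      refine ⟨hR', by simpa using h3', by simp, by omega, hout, ?_⟩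
      simp only [hex, hne, false_or]
      simpa using h10
    have hrm := hR.real m (by omega)
    have hrk := hR.real k hk
    refine HaltsWith.branch (T := 2) (fun t₁ => HaltsWith.branch (T := 1)
      (fun t₂ => HaltsWith.block ?_ (by simp)) fun t₂ => HaltsWith.skip (hne ?_))
      fun t₁ => HaltsWith.skip (hne ?_)
    · simp [Test.Holds, h3', hrm, hrk] at t₁ t₂
      have heq := le_antisymm t₂ t₁
      refine ⟨hR'.congr (fun a ha => ?_) ?_, ?_, ?_, by omega, ?_, ?_⟩
      · simp [Instr.exec, ha.ne]
      · simp [Instr.exec]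
      · simp [Instr.exec, h3']
      · simp [Instr.exec]
      · simp [Instr.exec, hout]
      · rw [if_pos (hex.2 (Or.inl heq))]
        simp [Instr.exec]
    · simp [Test.Holds, h3', hrm, hrk] at t₂
      exact t₂.ne'
    · simp [Test.Holds, h3', hrm, hrk] at t₁
      exact t₁.ne
  · rintro s' ⟨hR, h3', -, -, hout, h10⟩
    exact ⟨hR, h3', hout, by simpa using h10⟩

theorem haltsWith_writeProgram {k : ℕ} {s : State} (hs : Ready N x s) (h3 : s.nat 3 = k)
    (hk : k ≤ d) : HaltsWith writeProgram s (8 * d + 2) fun s' => Ready N x s' ∧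
      s'.nat 3 = k ∧ s'.out = s.out ++ (List.range d).map (roundAt N x (level N x k)) := by
  let I : ℕ → State → Prop := fun m s' => Ready N x s' ∧ s'.nat 3 = k ∧ s'.nat 4 = m ∧ m ≤ d ∧
    s'.out = s.out ++ (List.range (d - m)).map (roundAt N x (level N x k))
  have hS := hs.setup
  refine (HaltsWith.seq (T := 1) (T' := d * (7 + 1) + 1) (Q := I d)
    (HaltsWith.block ?_ (by simp)) fun s₁ h₁ =>
      (HaltsWith.loop (I := I) (fun n s' h' => ⟨h'.1.setup.nat2, h'.2.2.1⟩) ?_ h₁).mono le_rfl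
        ?_).mono (by omega) fun _ => id
  · refine ⟨hs.congr (fun a ha => ?_) ?_, ?_, ?_, le_rfl, ?_⟩
    · simp [Instr.exec, ha.ne]
    · simp [Instr.exec]
    · simp [Instr.exec, h3]
    · simp [Instr.exec, hS.nat0, hS.nat13]
    · simp [Instr.exec]
  · rintro m s₂ ⟨hR, h3', h4', hmd, hout⟩
    have hS₂ := hR.setup
    obtain ⟨j, hj⟩ : ∃ j, d - (m + 1) = j := ⟨_, rfl⟩
    have hjd : j < d := by omega
    have hj' : d - m = j + 1 := by omega
    refine HaltsWith.seq (T := 3) (T' := 4) (Q := fun s' => Ready N x s' ∧ s'.nat 3 = k ∧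
      s'.nat 4 = m + 1 ∧ s'.nat 9 = j ∧ s'.nat 5 = base N x j ∧ s'.out = s₂.out)
      (HaltsWith.block ?_ (by simp)) ?_
    · have : 16 + j ≠ 9 ∧ 16 + j ≠ 11 := by omega
      refine ⟨hR.congr (fun a ha => ?_) ?_, ?_, ?_, ?_, ?_, ?_⟩
      · simp [Instr.exec, ha.ne]
      · simp [Instr.exec]
      · simp [Instr.exec, h3']
      · simp [Instr.exec, h4']
      · simp [Instr.exec, hS₂.nat0, h4', hj]
      · simp [Instr.exec, hS₂.nat0, hS₂.nat6, h4', hj, this, hR.array j hjd]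
      · simp [Instr.exec]
    rintro s₃ ⟨hR₃, h3₃, h4₃, h9₃, h5₃, hout₃⟩
    have hrj := hR₃.real j hjd.le
    have hrk := hR₃.real k hk
    refine HaltsWith.seq (T := 2) (T' := 2) (Q := fun s' => Ready N x s' ∧ s'.nat 3 = k ∧
      s'.nat 4 = m + 1 ∧ s'.nat 5 = roundAt N x (level N x k) j ∧ s'.out = s₂.out)
      (HaltsWith.branch (T := 1) (fun ht => HaltsWith.skip ?_)
        fun ht => HaltsWith.block ?_ (by simp)) ?_
    · simp [Test.Holds, h3₃, h9₃, hrj, hrk] at ht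
      exact ⟨hR₃, h3₃, h4₃, by simp [roundAt, h5₃, ht], hout₃⟩
    · simp [Test.Holds, h3₃, h9₃, hrj, hrk] at ht
      refine ⟨hR₃.congr (fun a ha => ?_) ?_, ?_, ?_, ?_, ?_⟩
      · simp [Instr.exec, ha.ne]
      · simp [Instr.exec]
      · simp [Instr.exec, h3₃]
      · simp [Instr.exec, h4₃]
      · simp [Instr.exec, roundAt, h5₃, ht, hR₃.setup.nat2]
      · simp [Instr.exec, hout₃]
    rintro s₄ ⟨hR₄, h3₄, h4₄, h5₄, hout₄⟩
    refine HaltsWith.block ⟨hR₄.congr (fun a ha => ?_) ?_, ?_, ?_, by omega, ?_⟩ (by simp)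
    · simp [Instr.exec, ha.ne]
    · simp [Instr.exec]
    · simp [Instr.exec, h3₄]
    · simp [Instr.exec, h4₄, hR₄.setup.nat2]
    · simp [Instr.exec, h5₄, hout₄, hout, hj, hj', List.range_succ]
  · rintro s' ⟨hR, h3', -, -, hout⟩
    exact ⟨hR, h3', by simpa using hout⟩

/-- Distinct thresholds give distinct vertices. -/
theorem level_eq_of_roundAt_eq (hN : 2 ≤ N) (hx : x ∈ unitCube d) {k l : ℕ} (hk : k ≤ d)
    (hl : l ≤ d)
    (h : ∀ i : Fin d, roundAt N x (level N x k) i = roundAt N x (level N x l) i) :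
    level N x k = level N x l := by
  have key : ∀ {k l : ℕ}, l ≤ d →
      (∀ i : Fin d, roundAt N x (level N x k) i = roundAt N x (level N x l) i) →
      level N x l ≤ level N x k := by
    intro k l hl h
    rcases hl.eq_or_lt with rfl | hl
    · rw [level_self]
      exact level_nonneg hN hx k
    · by_contra! hlt
      simpa [roundAt, hlt] using h ⟨l, hl⟩
  exact le_antisymm (key hk fun i => (h i).symm) (key hl h)

/-- Invariant of the loop that writes the vertices: those of the first occurrences of thresholds
among the indices at least `k` have been written. -/
def ListInv (N : ℕ) (x : Fin d → ℝ) (k : ℕ) (s : State) : Prop :=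
  Ready N x s ∧ s.nat 3 = k ∧ k ≤ d + 1 ∧ ∃ L : List (Fin d → Fin N), L.Nodup ∧
    (∀ v, v ∈ L ↔ ∃ l ≤ d, k ≤ l ∧ (∀ j < l, level N x j ≠ level N x l) ∧
      ∀ i, (v i : ℕ) = roundAt N x (level N x l) i) ∧
    s.out = L.flatMap fun v => List.ofFn fun i => (v i : ℕ)

theorem haltsWith_listStep (hN : 2 ≤ N) (hx : x ∈ unitCube d) {k : ℕ} {s : State}
    (h : ListInv N x (k + 1) s) :
    HaltsWith (.seq (block [.sub 3 3 2])
      (.seq duplicateProgram (.branch (.natLE 10 13) writeProgram .skip))) s (13 * d + 7)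
      (ListInv N x k) := by
  obtain ⟨hR, h3, hk, L, hL, hmem, hout⟩ := h
  have hkd : k ≤ d := by omega
  refine (HaltsWith.seq (T := 1) (T' := (5 * k + 3) + (8 * d + 3)) (Q := fun s' => Ready N x s' ∧
      s'.nat 3 = k ∧ s'.out = s.out) (HaltsWith.block ?_ (by simp)) ?_).mono (by omega)
      fun _ => id
  · refine ⟨hR.congr (fun a ha => ?_) ?_, ?_, ?_⟩
    · simp [Instr.exec, ha.ne]
    · simp [Instr.exec]
    · simp [Instr.exec, h3, hR.setup.nat2]
    · simp [Instr.exec]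
  rintro s₁ ⟨hR₁, h3₁, hout₁⟩
  refine HaltsWith.seq (haltsWith_duplicateProgram hR₁ h3₁ hkd) ?_
  rintro s₂ ⟨hR₂, h3₂, hout₂, h10⟩
  refine HaltsWith.branch (T := 8 * d + 2) (fun ht => ?_) fun ht => HaltsWith.skip ?_
  · have hnew : ∀ j < k, level N x j ≠ level N x k := by
      by_contra! hcon
      simp [Test.Holds, h10, hR₂.setup.nat13] at ht
      obtain ⟨j, hj, hjk⟩ := hcon
      exact ht j hj hjk
    refine (haltsWith_writeProgram hR₂ h3₂ hkd).mono le_rfl ?_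
    rintro s₃ ⟨hR₃, h3₃, hout₃⟩
    let v : Fin d → Fin N := fun i =>
      ⟨roundAt N x (level N x k) i, roundAt_lt hN hx (level_nonneg hN hx k) i⟩
    refine ⟨hR₃, h3₃, by omega, L ++ [v], ?_, fun w => ?_, ?_⟩
    · rw [List.nodup_append]
      refine ⟨hL, List.nodup_singleton v, ?_⟩
      rintro w hw _ hv rfl
      rw [List.mem_singleton] at hv
      subst hv
      obtain ⟨l, hl, hkl, hfirst, hvl⟩ := (hmem v).1 hw
      exact hfirst k hkl (level_eq_of_roundAt_eq hN hx hkd hl fun i => hvl i)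
    · rw [List.mem_append, hmem, List.mem_singleton]
      constructor
      · rintro (⟨l, hl, hkl, h5⟩ | rfl)
        · exact ⟨l, hl, by omega, h5⟩
        · exact ⟨k, hkd, le_rfl, hnew, fun i => rfl⟩
      · rintro ⟨l, hl, hkl, h5, h6⟩
        rcases hkl.eq_or_lt with rfl | hkl
        · right
          ext i
          exact h6 i
        · exact Or.inl ⟨l, hl, hkl, h5, h6⟩
    · rw [hout₃, hout₂, hout₁, hout, List.flatMap_append, List.flatMap_singleton]
      congr 1
      refine List.ext_getElem (by simp) fun n h5 h6 => ?_
      simp [v]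
  · refine ⟨hR₂, h3₂, by omega, L, hL, fun w => ?_, by rw [hout₂, hout₁, hout]⟩
    rw [hmem]
    have hold : ∃ j < k, level N x j = level N x k := by
      by_contra hcon
      rw [if_neg hcon] at h10
      simp [Test.Holds, h10, hR₂.setup.nat13] at ht
    constructor
    · rintro ⟨l, hl, hkl, h5⟩
      exact ⟨l, hl, by omega, h5⟩
    · rintro ⟨l, hl, hkl, h5, h6⟩
      rcases hkl.eq_or_lt with rfl | hkl
      · obtain ⟨j, hj, hjk⟩ := hold
        exact absurd hjk (h5 j hj)
      · exact ⟨l, hl, hkl, h5, h6⟩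

/-- As `inStar_iff`, with every threshold represented by the first index at which it occurs. -/
theorem inStar_iff_first (hN : 2 ≤ N) (hx : x ∈ unitCube d) {v : Fin d → Fin N} :
    InStar v x ↔ ∃ l ≤ d, (∀ j < l, level N x j ≠ level N x l) ∧
      ∀ i, (v i : ℕ) = roundAt N x (level N x l) i := by
  classical
  rw [inStar_iff hN hx]
  constructor
  · rintro ⟨k, hk, hv⟩
    have hex : ∃ l, level N x l = level N x k := ⟨k, rfl⟩
    refine ⟨Nat.find hex, (Nat.find_min' hex rfl).trans hk, fun j hj => ?_, ?_⟩
    · rw [Nat.find_spec hex]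
      exact Nat.find_min hex hj
    · rwa [Nat.find_spec hex]
  · rintro ⟨l, hl, -, hv⟩
    exact ⟨l, hl, hv⟩

theorem computes_listProgram (hN : 2 ≤ N) (hx : x ∈ unitCube d) :
    Computes listProgram (30 * (d + N + 1) ^ 2) x (activeVertices (coeff (N := N)) x) := by
  have h : HaltsWith listProgram (initialState N x)
      (6 + ((d * (6 * N + 8 + 1) + 1) + (1 + ((d + 1) * (13 * d + 7 + 1) + 1))))
      (ListInv N x 0) := by
    refine HaltsWith.seq (Q := PrepareInv N x d) (HaltsWith.block ?_ (by simp)) fun s₁ h₁ =>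
      HaltsWith.seq (HaltsWith.loop (I := PrepareInv N x)
        (fun n s' h' => ⟨h'.setup.nat2, h'.nat3⟩)
        (fun i s' h' => haltsWith_scaleProgram hN hx h') h₁) fun s₂ h₂ =>
      HaltsWith.seq (Q := ListInv N x (d + 1)) (HaltsWith.block ?_ (by simp)) fun s₃ h₃ =>
      HaltsWith.loop (I := ListInv N x) (fun n s' h' => ⟨h'.1.setup.nat2, h'.2.1⟩)
        (fun i s' h' => haltsWith_listStep hN hx h') h₃
    · refine ⟨⟨?_, ?_, ?_, ?_, ?_, ?_, ?_, ?_, ?_⟩, ?_, le_rfl, ?_, ?_, ?_, ?_⟩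
      · simp [Instr.exec, initialState]
      · simp [Instr.exec, initialState]
      · simp [Instr.exec, initialState]
      · simp [Instr.exec, initialState]
      · simp [Instr.exec, initialState]
      · simp [Instr.exec, initialState]
      · simp [Instr.exec, initialState]
      · have : d ≠ d + 1 + 1 := by omega
        simp [Instr.exec, initialState, this]
      · simp [Instr.exec, initialState]
      · simp [Instr.exec, initialState]
      · intro j _
        have : (j : ℕ) ≠ d + 1 + 1 := by omega
        simp [Instr.exec, initialState, this]
      · intro j h5 h6
        omega
      · intro j h5 h6
        omega
      · simp [Instr.exec, initialState]
    · have hS := h₂.setup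
      refine ⟨⟨hS.congr (fun a _ ha => ?_) ?_ ?_, fun k hk => ?_, fun j hj => ?_⟩, ?_, le_rfl,
        [], List.nodup_nil, fun v => ?_, ?_⟩
      · simp [Instr.exec, ha.ne]
      · simp [Instr.exec]
      · simp [Instr.exec]
      · rcases hk.eq_or_lt with rfl | hk
        · simp [Instr.exec, hS.real_self, level_self]
        · simp [Instr.exec, h₂.real k hk]
      · have : 16 + j ≠ 3 := by omega
        simp [Instr.exec, this, h₂.array j hj]
      · simp [Instr.exec, hS.nat0, hS.nat2]
      · refine iff_of_false (by simp) ?_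
        rintro ⟨l, h5, h6, -⟩
        omega
      · simp [Instr.exec, h₂.out]
  obtain ⟨k, hk, s, hr, -, -, -, L, hL, hmem, hout⟩ := h
  refine ⟨k, hk.trans (by nlinarith), s, hr, L, hL, fun v => ?_, hout⟩
  rw [hmem, mem_activeVertices_iff hN hx, inStar_iff_first hN hx]
  simp

end

/-! ### The coefficients are smooth and efficient -/

theorem isSEIC_coeff {C : ℝ} (hC : 1 ≤ C) (h₁ : ∀ y, |deriv Real.smoothTransition y| ≤ C)
    (h₂ : ∀ y, |deriv (deriv Real.smoothTransition) y| ≤ C) {d N T : ℕ} (hN : 2 ≤ N)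
    (hT : 30 * (d + N + 1) ^ 2 ≤ T) :
    IsSEIC ((240 * C) ^ 2) listProgram T (coeff (d := d) (N := N)) := by
  have hpos := sub_one_pos hN
  have hb := jetBound_bump hC h₁ h₂ hN (d := d)
  have hjet := fun v x (hx : x ∈ unitCube d) => jetBound_coeff hN hb hx v
  have hc := fun v x hx => (hjet v x hx).contDiffAt
  have hvanish := fun v x (hx : x ∈ unitCube d) =>
    coeff_vanish (v := v) hN (fun w y => (hb w y).contDiffAt) hx
  have hconst : ∀ _ : Fin d, 3 * (2 * (d : ℝ) + 3) * (2 * C * ((d : ℝ) + 1) ^ 3 * ((N : ℝ) - 1)) ≤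
      240 * C * ((d : ℝ) ^ 12 / meshSize N) := by
    intro i
    have hd : (1 : ℝ) ≤ d := by exact_mod_cast i.pos
    rw [meshSize, div_div_eq_mul_div, div_one]
    calc _ ≤ 3 * (5 * (d : ℝ)) * (2 * C * (2 * (d : ℝ)) ^ 3 * ((N : ℝ) - 1)) := by
          gcongr <;> linarith
      _ = 240 * C * ((d : ℝ) ^ 4 * ((N : ℝ) - 1)) := by ring
      _ ≤ _ := by
          gcongr
          norm_num
  have hK : 240 * C ≤ (240 * C) ^ 2 := by nlinarith
  have hsingle : ∀ i : Fin d, ‖(Pi.single i 1 : Fin d → ℝ)‖ = 1 := by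
    intro i
    rw [Pi.norm_single, norm_one]
  have hmesh : 0 < meshSize N := one_div_pos.2 hpos
  refine ⟨fun v x hx => (hc v x hx).contDiffWithinAt, fun v x hx i => ?_, fun v x hx i l => ?_,
    fun v x hx => coeff_nonneg hN hx v, fun x hx => sum_coeff hN hx,
    fun x hx => sum_corners_coeff hN hx, fun x hx => card_activeVertices_le hN hx,
    fun x hx v hv => ?_, fun x hx => activeVertices_subset_corners hN hx, fun x hx => ?_,
    fun x hx i => exists_mem_activeVertices_low hN hx,
    fun x hx i => exists_mem_activeVertices_high hN hx⟩
  · rw [partialDeriv_eq hx ((hc v x hx).differentiableAt (by simp))]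
    have h := (fderiv ℝ (coeff v) x).le_opNorm (Pi.single i 1)
    rw [hsingle, mul_one, Real.norm_eq_abs] at h
    refine (h.trans (hjet v x hx).norm_fderiv_le).trans ((hconst i).trans ?_)
    gcongr
  · rw [partialDeriv_partialDeriv_eq (hc v) hx]
    have h := (fderiv ℝ (fderiv ℝ (coeff v)) x).le_opNorm₂ (Pi.single i 1) (Pi.single l 1)
    rw [hsingle, hsingle, mul_one, mul_one, Real.norm_eq_abs] at h
    refine (h.trans (hjet v x hx).norm_fderiv_fderiv_le).trans ?_
    calc _ ≤ (240 * C * ((d : ℝ) ^ 12 / meshSize N)) ^ 2 :=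
          pow_le_pow_left₀ (hjet v x hx).nonneg (hconst i) 2
      _ = _ := by ring
  · rw [mem_activeVertices_iff hN hx] at hv
    obtain ⟨h0, hD, hDD⟩ := hvanish v x hx hv
    refine ⟨h0, fun i => ?_, fun i l => ?_⟩
    · rw [partialDeriv_eq hx ((hc v x hx).differentiableAt (by simp)), hD]
      rfl
    · rw [partialDeriv_partialDeriv_eq (hc v) hx, hDD]
      rfl
  · obtain ⟨k, hk, h⟩ := computes_listProgram hN hx
    exact ⟨k, hk.trans hT, h⟩

end SEIC

theorem mainTheorem7 :
    ∃ (K : ℝ) (A : SEIC.Program), ∀ q : Polynomial ℕ, ∃ τ : Polynomial ℕ,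
      ∀ d N : ℕ, 2 ≤ N → N ≤ q.eval d →
        ∃ P : (Fin d → Fin N) → (Fin d → ℝ) → ℝ, SEIC.IsSEIC K A (τ.eval d) P := by
  obtain ⟨C, hC, h₁, h₂⟩ := SEIC.exists_bound_deriv_smoothTransition
  refine ⟨(240 * C) ^ 2, SEIC.listProgram, fun q =>
    ⟨30 * (Polynomial.X + q + 1) ^ 2, fun d N hN hNq =>
      ⟨SEIC.coeff, SEIC.isSEIC_coeff hC h₁ h₂ hN ?_⟩⟩⟩
  simp only [Polynomial.eval_mul, Polynomial.eval_pow, Polynomial.eval_add, Polynomial.eval_X,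
    Polynomial.eval_one, Polynomial.eval_ofNat]
  gcongr
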